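/- Let $d\ge 3$ and $n\ge 1$ be integers. Real tensors $A=[a_{i_1\dots i_d}]$ of order $d$ and format $n\times\dots\times n$ carry the Frobenius inner product $\langle A,B\rangle_F=\sum a_{i_1\dots i_d}b_{i_1\dots i_d}$ and the norm $\|A\|_F=\langle A,A\rangle_F^{1/2}$. For symmetric $A$ the spectral norm is $\|A\|_\sigma=\max_{0\ne u\in\mathbb R^n}|\langle A,u^{\otimes d}\rangle_F|/\|u\|^d$. A tensor has rank at most two if it is the sum of two (possibly zero) tensors $x_1\otimes\dots\otimes x_d$ with $x_k \in \mathbb R^n$, and border rank at most two if it is a limit of tensors of rank at most two. (i) If $A\neq 0$ is a real symmetric tensor of order $d$ and rank at most two, then $$\|A\|_\sigma>\left(1-\frac1d\right)^{\frac{d-1}{2}}\|A\|_F .$$ Let now $n\ge 2$. (ii) This bound is sharp: the infimum of $\|A\|_\sigma/\|A\|_F$ over the nonzero symmetric tensors $A$ of rank at most two equals $(1-\frac1d)^{(d-1)/2}$. (iii) Among the symmetric tensors of border rank at most two the infimum is attained: $$\min_{\substack{A \text{ symmetric},\ A\ne 0\\ A \text{ of border rank at most } 2}}\frac{\|A\|_\sigma}{\|A\|_F}=\left(1-\frac1d\right)^{\frac{d-1}{2}}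 .$$ (iv) Let $e_1,e_2$ be the first two standard basis vectors of $\mathbb R^n$ and let $$W_d=\lim_{t\to0}\frac1t\left[(e_1+te_2)^{\otimes d}-e_1^{\otimes d}\right]=d\,e_1^{d-1}e_2,$$ where $e_1^{d-1}e_2$ is the symmetrization (average over all permutations of the factors) of $e_1^{\otimes (d-1)}\otimes e_2$. The tensors at which the minimum in (iii) is attained are exactly $s\,(Q\cdot W_d)$ with $s\in\mathbb R\setminus\{0\}$ and $Q$ a real orthogonal $n\times n$ matrix, where $Q$ acts on tensors by $Q\cdot(x_1\otimes\dots\otimes x_d)=Qx_1\otimes\dots\otimes Qx_d$. -/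

import Mathlib

open Filter Topology

namespace RealTensor

/-- The Euclidean space `ℝⁿ`. -/
abbrev Vec (n : ℕ) : Type := EuclideanSpace ℝ (Fin n)

/-- Real `n × ⋯ × n` tensors of order `d`, as arrays `A i` indexed by `i = (i₁, …, i_d)`.
The norm of this Euclidean space is the Frobenius norm, its inner product the Frobenius one. -/
abbrev Tensor (d n : ℕ) : Type := EuclideanSpace ℝ (Fin d → Fin n)

/-- `A` is invariant under all permutations of its indices. -/
def IsSymm {d n : ℕ} (A : Tensor d n) : Prop :=
  ∀ (σ : Equiv.Perm (Fin d)) (i : Fin d → Fin n), A (i ∘ σ) = A i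

/-- The elementary tensor `x₁ ⊗ ⋯ ⊗ x_d`. -/
def outer {d n : ℕ} (x : Fin d → Vec n) : Tensor d n :=
  WithLp.toLp 2 fun i => ∏ k, x k (i k)

/-- The symmetric elementary tensor `u^d = u ⊗ ⋯ ⊗ u`. -/
def power (d : ℕ) {n : ℕ} (u : Vec n) : Tensor d n :=
  outer fun _ => u

/-- The symmetrization `x₁ x₂ ⋯ x_d` of `x₁ ⊗ ⋯ ⊗ x_d`. -/
noncomputable def symProd {d n : ℕ} (x : Fin d → Vec n) : Tensor d n :=
  ((d.factorial : ℝ)⁻¹) • ∑ σ : Equiv.Perm (Fin d), outer (x ∘ σ)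

/-- The homogeneous polynomial `p_A(u) = ∑ a_{i₁…i_d} u_{i₁} ⋯ u_{i_d} = ⟨A, u^d⟩_F`. -/
noncomputable def form {d n : ℕ} (A : Tensor d n) (u : Vec n) : ℝ :=
  ∑ i : Fin d → Fin n, A i * ∏ k, u (i k)

/-- The spectral norm `‖A‖_σ = max_{u ≠ 0} |p_A(u)| / ‖u‖^d` of a symmetric tensor. -/
noncomputable def specNorm {d n : ℕ} (A : Tensor d n) : ℝ :=
  sSup {r : ℝ | ∃ u : Vec n, u ≠ 0 ∧ r = |form A u| / ‖u‖ ^ d}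

/-- `rank A ≤ r`: `A` is a sum of `r` (possibly zero) elementary tensors, with no symmetry
required of the summands. -/
def RankLE {d n : ℕ} (r : ℕ) (A : Tensor d n) : Prop :=
  ∃ (c : Fin r → ℝ) (x : Fin r → Fin d → Vec n), A = ∑ j, c j • outer (x j)

/-- Border rank at most `r`: `A` lies in the closure of the tensors of rank at most `r`. -/
def BorderRankLE {d n : ℕ} (r : ℕ) (A : Tensor d n) : Prop :=
  A ∈ closure {B : Tensor d n | RankLE r B}

/-- The first standard basis vector. -/
noncomputable def e₁ (n : ℕ) (hn : 2 ≤ n) : Vec n := EuclideanSpace.single ⟨0, by omega⟩ 1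

/-- The second standard basis vector. -/
noncomputable def e₂ (n : ℕ) (hn : 2 ≤ n) : Vec n := EuclideanSpace.single ⟨1, by omega⟩ 1

/-- The tensor `W_d = d e₁^{d-1} e₂`. -/
noncomputable def W (d n : ℕ) (hn : 2 ≤ n) : Tensor d n :=
  (d : ℝ) • symProd fun k : Fin d => if k.val < d - 1 then e₁ n hn else e₂ n hn

/-- The action of a matrix `Q` on tensors that sends `x₁ ⊗ ⋯ ⊗ x_d` to `Qx₁ ⊗ ⋯ ⊗ Qx_d`. -/
noncomputable def act {d n : ℕ} (Q : Matrix (Fin n) (Fin n) ℝ) (A : Tensor d n) : Tensor d n :=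
  WithLp.toLp 2 fun i => ∑ j : Fin d → Fin n, (∏ k, Q (i k) (j k)) * A j

/-- The maximum in the definition of the spectral norm is attained. -/
theorem specNorm_isGreatest {d n : ℕ} (hn : 1 ≤ n) (A : Tensor d n) :
    IsGreatest {r : ℝ | ∃ u : Vec n, u ≠ 0 ∧ r = |form A u| / ‖u‖ ^ d} (specNorm A) := by
  have hc : Continuous fun u : Vec n => |form A u| := by
    unfold form
    fun_prop
  have hne : (Metric.sphere (0 : Vec n) 1).Nonempty :=
    ⟨EuclideanSpace.single ⟨0, hn⟩ 1, by simp⟩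
  obtain ⟨w, hw, hmax⟩ := (isCompact_sphere (0 : Vec n) 1).exists_isMaxOn hne hc.continuousOn
  have hw1 : ‖w‖ = 1 := by simpa using hw
  have hg : IsGreatest {r : ℝ | ∃ u : Vec n, u ≠ 0 ∧ r = |form A u| / ‖u‖ ^ d} |form A w| := by
    refine ⟨⟨w, ?_, by simp [hw1]⟩, ?_⟩
    · rintro rfl
      simp at hw1
    · rintro r ⟨u, hu, rfl⟩
      have hpos : 0 < ‖u‖ := norm_pos_iff.mpr hu
      have hs : ‖u‖⁻¹ • u ∈ Metric.sphere (0 : Vec n) 1 := by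
        simp [norm_smul, hpos.ne']
      have hle : |form A (‖u‖⁻¹ • u)| ≤ |form A w| := hmax hs
      have hhom : form A (‖u‖⁻¹ • u) = form A u / ‖u‖ ^ d := by
        simp only [form, PiLp.smul_apply, smul_eq_mul, Finset.prod_mul_distrib,
          Finset.prod_const, Finset.card_univ, Fintype.card_fin, Finset.sum_div]
        refine Finset.sum_congr rfl fun i _ => ?_
        rw [inv_pow]
        ring
      rwa [hhom, abs_div, abs_of_pos (pow_pos hpos d)] at hle
  have : specNorm A = |form A w| := hg.csSup_eq
  rw [this]
  exact hg

end RealTensor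

/-!
Write `d = D + 1`.

*Normal forms.* A symmetric `A` of border rank at most two is `α u^d + β v^d` or
`c θ^d + s (d θ^{d-1} η)` with `θ, η` orthonormal (`IsSymm.classify`). The fibres of `A` span a
space `V` of dimension at most two, because linear independence of three vectors is an open
condition. If `dim V = 2`, there are unit vectors `η, ζ ∈ V` such that the multilinear form of `A`
vanishes as soon as `η` and `ζ` occur among its arguments: for
`x₁ ⊗ ⋯ ⊗ x_d + y₁ ⊗ ⋯ ⊗ y_d` take `η ⊥ x₁` in the first place and `ζ ⊥ y₂` in the second one,
and pass to the limit by compactness. Expanding the form in `η, ζ` gives two powers if these are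
independent, and a power plus a tangent tensor if `ζ = ± η`. The second form with `s ≠ 0` has rank
above two (`not_rankLE_two`): contracting a sum of two elementary tensors in the first place with a
vector that kills one of them leaves an elementary tensor, and this restricts that vector too much.

*The inequality.* For each normal form a vector `w` is exhibited with
`‖A‖² ‖w‖^{2d} < (d/D)^D p_A(w)²`. For two powers of equal sign at an acute angle the longer vector
does. For `a^d - b^d` with `⟨a, b⟩ ≥ 0` and `‖b‖ ≤ ‖a‖` there are two choices. Let `f` be the foot
of the perpendicular from the origin to the line through `a` and `b`, and let `ê` be the unit
vector in the direction of `a - b`. If `a` is far from `f`, then `w = a` works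
(`longVector_test`); otherwise `w = √D f/‖f‖ + ê` works (`footVector_test`), which is the direction
that is optimal for `W_d`. The latter is an inequality for the second difference of
`(1 + D x y)^d`, obtained by integrating a pointwise one, or termwise if the second argument is
negative. For `c θ^d + s (d θ^{d-1} η)` with `c ≠ 0` the vectors `θ` and `√D θ ± η` do, and for
`c = 0` the inequality of the arithmetic and geometric means yields equality
(`specNorm_smul_tangent`). The bound is therefore attained exactly at the multiples of
`d θ^{d-1} η` with `θ, η` orthonormal, and these are the images of multiples of `W_d` under
orthogonal maps. It is approached in rank two along difference quotients that tend to `W_d`.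
-/

namespace RealTensor

variable {d n : ℕ}

/-! ### The multilinear form of a tensor -/

/-- The multilinear form `(v₁, …, v_d) ↦ ⟨A, v₁ ⊗ ⋯ ⊗ v_d⟩` of the tensor `A`; the form `p_A` is its
restriction to the diagonal (`form_eq_multi`). -/
noncomputable def multi (A : Tensor d n) : MultilinearMap ℝ (fun _ : Fin d => Vec n) ℝ :=
  ∑ i : Fin d → Fin n, A i • (MultilinearMap.mkPiAlgebra ℝ (Fin d) ℝ).compLinearMap
    fun k => (EuclideanSpace.proj (𝕜 := ℝ) (i k) : Vec n →L[ℝ] ℝ).toLinearMap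

theorem multi_apply (A : Tensor d n) (v : Fin d → Vec n) :
    multi A v = ∑ i : Fin d → Fin n, A i * ∏ k, v k (i k) := by
  simp [multi]

theorem form_eq_multi (A : Tensor d n) (u : Vec n) : form A u = multi A fun _ => u := by
  rw [multi_apply, form]

theorem multi_add (A B : Tensor d n) (v : Fin d → Vec n) :
    multi (A + B) v = multi A v + multi B v := by
  simp [multi_apply, add_mul, Finset.sum_add_distrib]

theorem multi_smul (c : ℝ) (A : Tensor d n) (v : Fin d → Vec n) :
    multi (c • A) v = c * multi A v := by
  simp [multi_apply, mul_assoc, Finset.mul_sum]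

theorem multi_sum {ι : Type*} (s : Finset ι) (A : ι → Tensor d n) (v : Fin d → Vec n) :
    multi (∑ j ∈ s, A j) v = ∑ j ∈ s, multi (A j) v := by
  classical
  induction s using Finset.induction_on with
  | empty => simp [multi_apply]
  | insert j s hj ih => rw [Finset.sum_insert hj, Finset.sum_insert hj, multi_add, ih]

theorem multi_outer (x v : Fin d → Vec n) : multi (outer x) v = ∏ k, inner ℝ (x k) (v k) := by
  rw [multi_apply]
  simp only [PiLp.inner_apply, Finset.prod_univ_sum, Fintype.piFinset_univ, outer,
    ← Finset.prod_mul_distrib]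
  refine Finset.sum_congr rfl fun i _ => Finset.prod_congr rfl fun k _ => ?_
  simp [mul_comm]

theorem inner_outer (A : Tensor d n) (v : Fin d → Vec n) : inner ℝ A (outer v) = multi A v := by
  rw [multi_apply]
  simp only [PiLp.inner_apply, outer]
  exact Finset.sum_congr rfl fun i _ => by simp [mul_comm]

theorem multi_single (A : Tensor d n) (i : Fin d → Fin n) :
    multi A (fun k => EuclideanSpace.single (i k) (1 : ℝ)) = A i := by
  rw [multi_apply, Finset.sum_eq_single i]
  · simp
  · intro j _ hj
    obtain ⟨k, hk⟩ := Function.ne_iff.1 hj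
    rw [Finset.prod_eq_zero (Finset.mem_univ k), mul_zero]
    simp [hk]
  · simp

theorem ext_multi {A B : Tensor d n} (h : ∀ v, multi A v = multi B v) : A = B := by
  ext i
  rw [← multi_single A, ← multi_single B, h]

theorem IsSymm.multi_comp {A : Tensor d n} (hA : IsSymm A) (σ : Equiv.Perm (Fin d))
    (v : Fin d → Vec n) : multi A (v ∘ σ) = multi A v := by
  rw [multi_apply, multi_apply]
  refine Fintype.sum_equiv (Equiv.arrowCongr σ (Equiv.refl _)) _ _ fun i => ?_
  have h : A (Equiv.arrowCongr σ (Equiv.refl _) i) = A i := hA σ.symm i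
  rw [h]
  refine congrArg (A i * ·) (Fintype.prod_equiv σ _ _ fun k => ?_)
  simp

theorem isSymm_of_multi_comp {A : Tensor d n}
    (h : ∀ (σ : Equiv.Perm (Fin d)) v, multi A (v ∘ σ) = multi A v) : IsSymm A := by
  intro σ i
  rw [← multi_single A (i ∘ σ), ← multi_single A i]
  exact h σ fun k => EuclideanSpace.single (i k) (1 : ℝ)

theorem continuous_multi : Continuous fun p : Tensor d n × (Fin d → Vec n) => multi p.1 p.2 := by
  simp only [multi_apply]
  fun_prop

theorem norm_outer (x : Fin d → Vec n) : ‖outer x‖ = ∏ k, ‖x k‖ := by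
  have h : ‖outer x‖ ^ 2 = (∏ k, ‖x k‖) ^ 2 := by
    rw [← real_inner_self_eq_norm_sq, inner_outer, multi_outer, ← Finset.prod_pow]
    simp
  exact (sq_eq_sq₀ (norm_nonneg _) (Finset.prod_nonneg fun _ _ => norm_nonneg _)).1 h

theorem abs_form_le (A : Tensor d n) (u : Vec n) : |form A u| ≤ ‖A‖ * ‖u‖ ^ d := by
  rw [form_eq_multi, ← inner_outer]
  refine (abs_real_inner_le_norm _ _).trans_eq ?_
  rw [norm_outer]
  simp

/-- The tensor `∑ⱼ θ ⊗ ⋯ ⊗ η ⊗ ⋯ ⊗ θ` with `η` in place `j`, that is `d θ^{d-1} η`. -/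
noncomputable def tangent (d : ℕ) {n : ℕ} (θ η : Vec n) : Tensor d n :=
  ∑ j : Fin d, outer (Function.update (fun _ => θ) j η)

theorem multi_power (u : Vec n) (v : Fin d → Vec n) :
    multi (power d u) v = ∏ k, inner ℝ u (v k) := multi_outer _ _

theorem multi_tangent (θ η : Vec n) (v : Fin d → Vec n) :
    multi (tangent d θ η) v =
      ∑ j, inner ℝ η (v j) * ∏ k ∈ Finset.univ.erase j, inner ℝ θ (v k) := by
  rw [tangent, multi_sum]
  refine Finset.sum_congr rfl fun j _ => ?_
  rw [multi_outer, ← Finset.mul_prod_erase _ _ (Finset.mem_univ j), Function.update_self]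
  congr 1
  refine Finset.prod_congr rfl fun k hk => ?_
  rw [Function.update_of_ne (Finset.ne_of_mem_erase hk)]

theorem form_add (A B : Tensor d n) (u : Vec n) : form (A + B) u = form A u + form B u := by
  simp only [form_eq_multi, multi_add]

theorem form_smul (c : ℝ) (A : Tensor d n) (u : Vec n) : form (c • A) u = c * form A u := by
  simp only [form_eq_multi, multi_smul]

theorem form_power (u w : Vec n) : form (power d u) w = inner ℝ u w ^ d := by
  rw [form_eq_multi, multi_power]
  simp

theorem form_tangent (θ η w : Vec n) :
    form (tangent d θ η) w = d * (inner ℝ θ w ^ (d - 1) * inner ℝ η w) := by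
  rw [form_eq_multi, multi_tangent]
  simp only [Finset.prod_const, Finset.card_erase_of_mem (Finset.mem_univ _), Finset.card_univ,
    Fintype.card_fin, Finset.sum_const, nsmul_eq_mul]
  ring

theorem inner_power_right (A : Tensor d n) (u : Vec n) : inner ℝ A (power d u) = form A u := by
  rw [form_eq_multi]; exact inner_outer _ _

theorem norm_sq_power_add_power (α β : ℝ) (u v : Vec n) :
    ‖α • power d u + β • power d v‖ ^ 2 =
      α ^ 2 * (‖u‖ ^ 2) ^ d + 2 * α * β * inner ℝ u v ^ d + β ^ 2 * (‖v‖ ^ 2) ^ d := by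
  rw [← real_inner_self_eq_norm_sq, inner_add_right, inner_smul_right, inner_smul_right,
    inner_power_right, inner_power_right, form_add, form_add, form_smul, form_smul, form_smul,
    form_smul, form_power, form_power, form_power, form_power, real_inner_comm u v,
    real_inner_self_eq_norm_sq, real_inner_self_eq_norm_sq]
  ring

theorem norm_sq_power_add_tangent {θ η : Vec n} (hθ : ‖θ‖ = 1) (hη : ‖η‖ = 1)
    (h : inner ℝ θ η = 0) (c s : ℝ) :
    ‖c • power d θ + s • tangent d θ η‖ ^ 2 = c ^ 2 + d * s ^ 2 := by
  have hθ' : inner ℝ θ θ = (1 : ℝ) := by rw [real_inner_self_eq_norm_sq, hθ]; norm_num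
  have hη' : inner ℝ η η = (1 : ℝ) := by rw [real_inner_self_eq_norm_sq, hη]; norm_num
  have h' : inner ℝ η θ = (0 : ℝ) := by rw [real_inner_comm, h]
  have h1 : inner ℝ (tangent d θ η) (tangent d θ η) = (d : ℝ) := by
    have : ∀ j : Fin d, inner ℝ (tangent d θ η) (outer (Function.update (fun _ => θ) j η)) =
        (1 : ℝ) := by
      intro j
      rw [inner_outer, multi_tangent, Finset.sum_eq_single j]
      · rw [Function.update_self, hη', one_mul]
        refine Finset.prod_eq_one fun k hk => ?_
        rw [Function.update_of_ne (Finset.ne_of_mem_erase hk), hθ']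
      · intro k _ hk
        rw [Function.update_of_ne hk, h', zero_mul]
      · simp
    generalize hT : tangent d θ η = T at this
    rw [tangent] at hT
    conv_lhs => rw [← hT, sum_inner]
    refine (Finset.sum_congr rfl fun j _ => (real_inner_comm _ _).trans (hT ▸ this j)).trans ?_
    simp
  have h2 : inner ℝ (tangent d θ η) (power d θ) = (0 : ℝ) := by
    rw [inner_power_right, form_tangent, h', mul_zero, mul_zero]
  have h3 : inner ℝ (power d θ) (power d θ) = (1 : ℝ) := by
    rw [inner_power_right, form_power, hθ', one_pow]
  rw [← real_inner_self_eq_norm_sq]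
  simp only [inner_add_left, inner_add_right, inner_smul_left, inner_smul_right, h1, h2, h3,
    real_inner_comm (tangent d θ η) (power d θ)]
  simp
  ring

theorem le_specNorm (hn : 1 ≤ n) (A : Tensor d n) {u : Vec n} (hu : u ≠ 0) :
    |form A u| / ‖u‖ ^ d ≤ specNorm A :=
  (specNorm_isGreatest hn A).2 ⟨u, hu, rfl⟩

theorem specNorm_le (hn : 1 ≤ n) (A : Tensor d n) {c : ℝ}
    (h : ∀ u : Vec n, u ≠ 0 → |form A u| / ‖u‖ ^ d ≤ c) : specNorm A ≤ c := by
  obtain ⟨u, hu, he⟩ := (specNorm_isGreatest hn A).1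
  rw [he]; exact h u hu

theorem specNorm_le_add (hn : 1 ≤ n) (A B : Tensor d n) :
    specNorm A ≤ specNorm B + ‖A - B‖ := by
  refine specNorm_le hn A fun u hu => ?_
  have hu0 : 0 < ‖u‖ ^ d := pow_pos (norm_pos_iff.2 hu) d
  have h1 := le_specNorm hn B hu
  have h2 := abs_form_le (A - B) u
  have h3 : form A u = form B u + form (A - B) u := by rw [← form_add]; simp
  rw [div_le_iff₀ hu0] at *
  rw [h3, add_mul]
  exact (abs_add_le _ _).trans (add_le_add h1 h2)

theorem continuous_specNorm (hn : 1 ≤ n) : Continuous (specNorm : Tensor d n → ℝ) := by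
  refine LipschitzWith.continuous (K := 1) (LipschitzWith.of_dist_le_mul fun A B => ?_)
  rw [Real.dist_eq, dist_eq_norm, NNReal.coe_one, one_mul, abs_le]
  have h1 := specNorm_le_add hn A B
  have h2 := specNorm_le_add hn B A
  rw [norm_sub_rev] at h2
  constructor <;> linarith

/-! ### Symmetric tensors, the orthogonal action and the tensor `W_d` -/

theorem isSymm_power (u : Vec n) : IsSymm (power d u) :=
  isSymm_of_multi_comp fun σ v => by
    rw [multi_power, multi_power]
    exact Fintype.prod_equiv σ _ _ fun _ => rfl

theorem IsSymm.add {A B : Tensor d n} (hA : IsSymm A) (hB : IsSymm B) : IsSymm (A + B) :=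
  fun σ i => by simp [hA σ i, hB σ i]

theorem IsSymm.smul {A : Tensor d n} (hA : IsSymm A) (c : ℝ) : IsSymm (c • A) :=
  fun σ i => by simp [hA σ i]

theorem isSymm_tangent (θ η : Vec n) : IsSymm (tangent d θ η) :=
  isSymm_of_multi_comp fun σ v => by
    simp only [tangent, multi_sum, multi_outer]
    refine Fintype.sum_equiv σ _ _ fun j => Fintype.prod_equiv σ _ _ fun k => ?_
    by_cases h : k = j
    · subst h; simp
    · rw [Function.update_of_ne h, Function.update_of_ne (by simpa using h)]; rfl

theorem act_outer (Q : Matrix (Fin n) (Fin n) ℝ) (x : Fin d → Vec n) :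
    act Q (outer x) = outer fun k => Matrix.toEuclideanLin Q (x k) := by
  ext i
  simp only [act, outer, Matrix.toLpLin_apply, Matrix.mulVec, dotProduct,
    Finset.prod_univ_sum, Fintype.piFinset_univ, Finset.prod_mul_distrib]

theorem act_sum {ι : Type*} (s : Finset ι) (Q : Matrix (Fin n) (Fin n) ℝ) (A : ι → Tensor d n) :
    act Q (∑ j ∈ s, A j) = ∑ j ∈ s, act Q (A j) := by
  ext i
  simp only [act, WithLp.ofLp_sum, Finset.sum_apply, Finset.mul_sum]
  exact Finset.sum_comm

theorem act_tangent (Q : Matrix (Fin n) (Fin n) ℝ) (θ η : Vec n) :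
    act Q (tangent d θ η) =
      tangent d (Matrix.toEuclideanLin Q θ) (Matrix.toEuclideanLin Q η) := by
  simp only [tangent, act_sum, act_outer]
  refine Finset.sum_congr rfl fun j _ => congrArg outer (funext fun k => ?_)
  by_cases h : k = j
  · subst h; simp
  · simp [Function.update_of_ne h]

theorem W_eq_tangent (hd : 1 ≤ d) (hn : 2 ≤ n) : W d n hn = tangent d (e₁ n hn) (e₂ n hn) := by
  set l : Fin d := ⟨d - 1, by omega⟩
  set f : Fin d → Tensor d n := fun j => outer (Function.update (fun _ => e₁ n hn) j (e₂ n hn))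
  have h0 : (fun k : Fin d => if k.val < d - 1 then e₁ n hn else e₂ n hn) =
      Function.update (fun _ => e₁ n hn) l (e₂ n hn) := by
    funext k
    by_cases h : k = l
    · subst h; simp [l]
    · rw [Function.update_of_ne h, if_pos]
      have : k.val ≠ d - 1 := fun h' => h (Fin.ext h')
      omega
  have h1 : ∀ σ : Equiv.Perm (Fin d),
      outer (Function.update (fun _ => e₁ n hn) l (e₂ n hn) ∘ σ) = f (σ.symm l) := by
    intro σ
    refine congrArg outer (funext fun k => ?_)
    by_cases h : k = σ.symm l
    · subst h; simp
    · rw [Function.update_of_ne h, Function.comp_apply,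
        Function.update_of_ne (fun h' => h (by rw [← h', Equiv.symm_apply_apply]))]
  have h2 : ∀ m : Fin d, ∑ σ : Equiv.Perm (Fin d), f (σ.symm m) =
      ∑ σ : Equiv.Perm (Fin d), f (σ.symm l) := by
    intro m
    refine Fintype.sum_equiv (Equiv.mulLeft (Equiv.swap m l)) _ _ fun σ => ?_
    simp [Equiv.Perm.mul_def]
  -- by `h2` the sum does not depend on the place `l`, so it may be averaged over all places
  have h3 : (d : ℝ) • ∑ σ : Equiv.Perm (Fin d), f (σ.symm l) =
      (d.factorial : ℝ) • ∑ j, f j := by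
    calc _ = ∑ m : Fin d, ∑ σ : Equiv.Perm (Fin d), f (σ.symm m) := by
          simp only [h2, Finset.sum_const, Finset.card_univ, Fintype.card_fin, Nat.cast_smul_eq_nsmul]
      _ = ∑ σ : Equiv.Perm (Fin d), ∑ m : Fin d, f (σ.symm m) := Finset.sum_comm
      _ = ∑ σ : Equiv.Perm (Fin d), ∑ j, f j :=
          Finset.sum_congr rfl fun σ _ => Equiv.sum_comp σ.symm f
      _ = _ := by
          simp only [Finset.sum_const, Finset.card_univ, Fintype.card_perm, Fintype.card_fin,
            Nat.cast_smul_eq_nsmul]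
  rw [W, symProd, h0]
  simp only [h1]
  rw [smul_comm, h3, smul_smul, inv_mul_cancel₀ (by positivity), one_smul, tangent]

theorem tendsto_tangent (x y : Vec n) :
    Tendsto (fun t : ℝ => t⁻¹ • (power d (x + t • y) - power d x)) (𝓝[≠] 0)
      (𝓝 (tangent d x y)) := by
  have key : HasDerivAt (fun t : ℝ => power d (x + t • y)) (tangent d x y) 0 := by
    have hp : ∀ i : Fin d → Fin n, HasDerivAt (fun t : ℝ => ∏ k, (x + t • y) (i k))
        (∑ j, (∏ k ∈ Finset.univ.erase j, x (i k)) • y (i j)) 0 := by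
      intro i
      have := HasDerivAt.fun_finsetProd (u := Finset.univ) (x := (0 : ℝ))
        (f := fun (k : Fin d) (t : ℝ) => (x + t • y) (i k)) (f' := fun k => y (i k)) (by
          intro k _
          have := (((hasDerivAt_id (0 : ℝ)).mul_const (y (i k))).const_add (x (i k)))
          simpa using this)
      simpa using this
    have h2 : HasDerivAt (fun t : ℝ => fun i : Fin d → Fin n => ∏ k, (x + t • y) (i k))
        (fun i => ∑ j, (∏ k ∈ Finset.univ.erase j, x (i k)) • y (i j)) 0 :=
      hasDerivAt_pi.2 hp
    have h3 := (PiLp.continuousLinearEquiv 2 ℝ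
      (fun _ : Fin d → Fin n => ℝ)).symm.toContinuousLinearMap.hasFDerivAt.comp_hasDerivAt
      (0 : ℝ) h2
    refine h3.congr_deriv ?_
    ext i
    simp only [tangent, outer, WithLp.ofLp_sum, Finset.sum_apply]
    change (∑ j, (∏ k ∈ Finset.univ.erase j, x (i k)) • y (i j) : ℝ) = _
    refine Finset.sum_congr rfl fun j _ => ?_
    rw [← Finset.mul_prod_erase _ _ (Finset.mem_univ j), Function.update_self, smul_eq_mul,
      mul_comm]
    congr 1
    refine Finset.prod_congr rfl fun k hk => ?_
    rw [Function.update_of_ne (Finset.ne_of_mem_erase hk)]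
  have := key.tendsto_slope_zero
  simpa using this

theorem rankLE_smul_power_add (α β : ℝ) (u v : Vec n) :
    RankLE 2 (α • power d u + β • power d v) :=
  ⟨![α, β], ![fun _ => u, fun _ => v], by simp [Fin.sum_univ_two, power]⟩

theorem borderRankLE_smul_tangent (c : ℝ) (x y : Vec n) :
    BorderRankLE 2 (c • tangent d x y) := by
  refine mem_closure_of_tendsto ((tendsto_tangent x y).const_smul c) ?_
  refine Eventually.of_forall fun t => ?_
  have : c • t⁻¹ • (power d (x + t • y) - power d x) =
      (c * t⁻¹) • power d (x + t • y) + (-(c * t⁻¹)) • power d x := by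
    rw [smul_smul, smul_sub, neg_smul, sub_eq_add_neg]
  rw [Set.mem_ofPred_eq, this]
  exact rankLE_smul_power_add _ _ _ _

/-! ### Inequalities between real numbers -/

theorem two_mul_lt_pow_sub_pow {m : ℝ} (hm : 0 < m) (hm1 : m ≤ 1) {D : ℕ} (hD : 2 ≤ D) :
    2 * (D + 1) * m < (1 + m) ^ (D + 1) - (1 - m) ^ (D + 1) := by
  induction D, hD using Nat.le_induction with
  | base => norm_num; nlinarith [pow_pos hm 3]
  | succ k hk ih =>
    have h1 : 1 + ((k + 1 : ℕ) : ℝ) * m ≤ (1 + m) ^ (k + 1) :=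
      one_add_mul_le_pow (by linarith) _
    have h2 : 1 + ((k + 1 : ℕ) : ℝ) * (-m) ≤ (1 + -m) ^ (k + 1) :=
      one_add_mul_le_pow (by linarith) _
    rw [← sub_eq_add_neg] at h2
    push_cast at *
    rw [pow_succ (1 + m) (k + 1), pow_succ (1 - m) (k + 1)]
    nlinarith

theorem one_add_mul_lt_pow_of_two_le {x : ℝ} (hx : 0 < x) {D : ℕ} (hD : 2 ≤ D) :
    1 + D * x < (1 + x) ^ D := by
  induction D, hD using Nat.le_induction with
  | base => norm_num; nlinarith
  | succ k hk ih =>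
    have : (0 : ℝ) ≤ k := by positivity
    push_cast
    rw [pow_succ]
    nlinarith [mul_nonneg this (sq_nonneg x)]

theorem mul_sub_le_pow_sub_pow {a b : ℝ} (hb : 1 ≤ b) (hab : b ≤ a) (k : ℕ) :
    k * (a - b) ≤ a ^ k - b ^ k := by
  induction k with
  | zero => simp
  | succ k ih =>
    push_cast
    have h1 : 1 ≤ b ^ k := one_le_pow₀ hb
    rw [pow_succ, pow_succ]
    have : a ^ k * a - b ^ k * b = (a ^ k - b ^ k) * a + b ^ k * (a - b) := by ring
    have h2 : 0 ≤ a ^ k - b ^ k := le_trans (by have := sub_nonneg.2 hab; positivity) ih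
    nlinarith

/-- The number `(d / (d - 1))^{d-1}` for `d = D + 1`, the inverse square of the sharp bound. -/
noncomputable def sharpConst (D : ℕ) : ℝ := (((D : ℝ) + 1) / D) ^ D

theorem two_lt_sharpConst {D : ℕ} (hD : 2 ≤ D) : 2 < sharpConst D := by
  have h0 : (0 : ℝ) < D := by positivity
  have := one_add_mul_lt_pow_of_two_le (x := 1 / (D : ℝ)) (by positivity) hD
  have h : 1 + 1 / (D : ℝ) = ((D : ℝ) + 1) / D := by field_simp
  rw [h, mul_one_div_cancel h0.ne'] at this
  unfold sharpConst
  linarith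

theorem sharpConst_mul {D : ℕ} (hD : 2 ≤ D) :
    sharpConst D * (D : ℝ) ^ D = ((D : ℝ) + 1) ^ D := by
  have h0 : (0 : ℝ) < D := by positivity
  unfold sharpConst
  rw [div_pow, div_mul_cancel₀ _ (by positivity)]

/-- The case `ε = 2 / d` of `mul_lt_sharpConst_mul`. After clearing denominators it is
`two_mul_lt_pow_sub_pow` at `m = 1 / D`. -/
theorem two_lt_sharpConst_mul {D : ℕ} (hD : 2 ≤ D) :
    2 < sharpConst D * (1 - (1 - 2 / ((D : ℝ) + 1)) ^ (D + 1)) := by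
  have h0 : (0 : ℝ) < D := by positivity
  have h1 : (1 : ℝ) ≤ D := by exact_mod_cast (by omega : 1 ≤ D)
  have := two_mul_lt_pow_sub_pow (m := 1 / (D : ℝ)) (by positivity)
    (by rw [div_le_one h0]; exact h1) hD
  have e1 : (1 : ℝ) + 1 / D = (D + 1) / D := by field_simp
  have e2 : (1 : ℝ) - 1 / D = (D + 1) / D * (1 - 2 / ((D : ℝ) + 1)) := by field_simp; ring
  rw [e1, e2, mul_pow, pow_succ ((D + 1 : ℝ) / D)] at this
  have h3 : (0 : ℝ) < (D + 1) / D := by positivity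
  have : (D + 1 : ℝ) / D * 2 <
      (D + 1 : ℝ) / D * (sharpConst D * (1 - (1 - 2 / ((D : ℝ) + 1)) ^ (D + 1))) := by
    unfold sharpConst
    calc (D + 1 : ℝ) / D * 2 = 2 * (D + 1) * (1 / D) := by ring
      _ < _ := this
      _ = _ := by ring
  exact lt_of_mul_lt_mul_left this h3.le

theorem pow_le_chord {a b t : ℝ} (ha : 0 ≤ a) (hb : 0 ≤ b) (ht : 0 ≤ t) (ht1 : t ≤ 1) (k : ℕ) :
    ((1 - t) * a + t * b) ^ k ≤ (1 - t) * a ^ k + t * b ^ k := by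
  have := (convexOn_pow (𝕜 := ℝ) k).2 (Set.mem_Ici.2 ha) (Set.mem_Ici.2 hb)
    (sub_nonneg.2 ht1) ht (by ring)
  simpa [smul_eq_mul] using this

/-- The right-hand side is concave in `ε` and vanishes at `ε = 0`, so that `ε = 2 / d` is the decisive
case. -/
theorem mul_lt_sharpConst_mul {D : ℕ} (hD : 2 ≤ D) {ε : ℝ} (h0 : 0 < ε)
    (h1 : ε * (D + 1) ≤ 2) :
    (D + 1) * ε < sharpConst D * (1 - (1 - ε) ^ (D + 1)) := by
  have hD0 : (2 : ℝ) ≤ D := by exact_mod_cast hD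
  have hc := pow_le_chord (a := 1) (b := 1 - 2 / ((D : ℝ) + 1)) (t := ε * (D + 1) / 2)
    (by norm_num) (by rw [sub_nonneg, div_le_one (by positivity)]; linarith)
    (by positivity) (by linarith) (D + 1)
  have e : (1 - ε * (D + 1) / 2) * 1 + ε * (D + 1) / 2 * (1 - 2 / ((D : ℝ) + 1)) = 1 - ε := by
    field_simp; ring
  rw [e, one_pow] at hc
  have hk := two_lt_sharpConst_mul hD
  have hk2 := two_lt_sharpConst hD
  have hpos : 0 < ε * (D + 1) / 2 := by positivity
  nlinarith

/-- The inequality that makes `w = a` a good test vector for `a^d - b^d`, with `‖a‖ = 1`,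
`⟨a, b⟩ = 1 - ε` and `‖b‖² = τ`. The upper bound `z` of `τ` lies between `(1 - ε)²` and `1 - ε` for
`ε ≤ 1 / d`, between `1 - ε` and `1` for `1 / d ≤ ε ≤ 2 / d`, and convexity of `x ↦ x^d` on the
interval concerned gives the estimate; for `ε ≥ 2 / d` the bound `τ ≤ 1` is enough. -/
theorem longVector_test_normalized {D : ℕ} (hD : 2 ≤ D) {ε τ : ℝ} (h0 : 0 < ε) (h1 : ε ≤ 1)
    (hτ0 : 0 ≤ τ) (hτ1 : τ ≤ 1) (hτ : τ ≤ (1 - ε) ^ 2 + D * ε ^ 2) :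
    1 - 2 * (1 - ε) ^ (D + 1) + τ ^ (D + 1) < sharpConst D * (1 - (1 - ε) ^ (D + 1)) ^ 2 := by
  have hD0 : (2 : ℝ) ≤ D := by exact_mod_cast hD
  set M := (1 - ε) ^ (D + 1) with hM
  have hM0 : 0 ≤ M := pow_nonneg (by linarith) _
  have hM1 : M < 1 := pow_lt_one₀ (by linarith) (by linarith) (by omega)
  have hk2 := two_lt_sharpConst hD
  rcases le_or_gt 2 (ε * (D + 1)) with h2 | h2
  · have hX : M ≤ (1 - 2 / ((D : ℝ) + 1)) ^ (D + 1) := by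
      refine pow_le_pow_left₀ (by linarith) ?_ _
      have : 2 / ((D : ℝ) + 1) ≤ ε := by rw [div_le_iff₀ (by positivity)]; linarith
      linarith
    have hB : τ ^ (D + 1) ≤ 1 := pow_le_one₀ hτ0 hτ1
    have hk := two_lt_sharpConst_mul hD
    have hk3 : 2 < sharpConst D * (1 - M) := by nlinarith
    nlinarith
  · set z := (1 - ε) ^ 2 + D * ε ^ 2 with hz
    have hB : τ ^ (D + 1) ≤ z ^ (D + 1) := pow_le_pow_left₀ hτ0 hτ _
    rcases le_or_gt (ε * (D + 1)) 1 with h3 | h3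
    · have hε : 0 < 1 - ε := by nlinarith
      have hc := pow_le_chord (a := (1 - ε) ^ 2) (b := 1 - ε) (t := D * ε / (1 - ε))
        (by positivity) hε.le (by positivity) (by rw [div_le_one hε]; linarith) (D + 1)
      have e : (1 - D * ε / (1 - ε)) * (1 - ε) ^ 2 + D * ε / (1 - ε) * (1 - ε) = z := by
        rw [hz]; field_simp; ring
      rw [e, ← pow_mul, mul_comm 2, pow_mul, ← hM] at hc
      have hN : 1 + ((D + 1 : ℕ) : ℝ) * (ε / (1 - ε)) ≤ (1 + ε / (1 - ε)) ^ (D + 1) :=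
        one_add_mul_le_pow (by have : 0 < ε / (1 - ε) := by positivity
                               linarith) _
      have e2 : 1 + ε / (1 - ε) = (1 - ε)⁻¹ := by field_simp; ring
      have hMpos : 0 < M := pow_pos hε _
      rw [e2, inv_pow, ← hM] at hN
      have hN2 := mul_le_mul_of_nonneg_left hN hM0
      rw [mul_inv_cancel₀ hMpos.ne'] at hN2
      push_cast at hN2
      have e3 : D * ε / (1 - ε) = D * (ε / (1 - ε)) := by ring
      have hη : 0 < ε / (1 - ε) := by positivity
      rw [e3] at hc
      set η := ε / (1 - ε)
      have : M * (D * η) ≤ 1 - M := by nlinarith [mul_pos hMpos hη]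
      have h5 : M * (D * η) * (1 - M) ≤ (1 - M) * (1 - M) :=
        mul_le_mul_of_nonneg_right this (by linarith)
      have h6 : 0 < (sharpConst D - 2) * (1 - M) ^ 2 :=
        mul_pos (by linarith) (pow_pos (by linarith) 2)
      linarith
    · have hc := pow_le_chord (a := 1 - ε) (b := 1) (t := ε * (D + 1) - 1)
        (by linarith) (by norm_num) (by linarith) (by linarith) (D + 1)
      have e : (1 - (ε * (D + 1) - 1)) * (1 - ε) + (ε * (D + 1) - 1) * 1 = z := by
        rw [hz]; ring
      rw [e, one_pow, ← hM] at hc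
      have := mul_lt_sharpConst_mul hD h0 h2.le
      rw [← hM] at this
      nlinarith

/-- The test vector `w = a` for `a^d - b^d`, where `p = ‖a‖²`, `q = ⟨a, b⟩` and `t = ‖b‖²`. The last
hypothesis says that the component of `b` orthogonal to `a` is small compared with the component of
`a - b` along `a`. -/
theorem longVector_test {D : ℕ} (hD : 2 ≤ D) {p q t : ℝ} (hq : 0 ≤ q) (hqp : q < p)
    (ht : 0 ≤ t) (htp : t ≤ p) (h : p * t - q ^ 2 ≤ D * (p - q) ^ 2) :
    p ^ (D + 1) * (p ^ (D + 1) - 2 * q ^ (D + 1) + t ^ (D + 1)) <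
      sharpConst D * (p ^ (D + 1) - q ^ (D + 1)) ^ 2 := by
  have hp : 0 < p := hq.trans_lt hqp
  have := longVector_test_normalized hD (ε := 1 - q / p) (τ := t / p)
    (by rw [sub_pos, div_lt_one hp]; exact hqp) (by have : 0 ≤ q / p := by positivity
                                                    linarith)
    (by positivity) ((div_le_one hp).2 htp) (by
      rw [← sub_nonneg]
      have : (1 - (1 - q / p)) ^ 2 + D * (1 - q / p) ^ 2 - t / p =
        (D * (p - q) ^ 2 - (p * t - q ^ 2)) / p ^ 2 := by field_simp; ring
      rw [this]
      exact div_nonneg (by linarith) (by positivity))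
  rw [sub_sub_cancel, div_pow, div_pow] at this
  have hP : 0 < p ^ (D + 1) := by positivity
  set P := p ^ (D + 1)
  have h3 := mul_lt_mul_of_pos_left this (pow_pos hP 2)
  calc _ = P ^ 2 * (1 - 2 * (q ^ (D + 1) / P) + t ^ (D + 1) / P) := by field_simp
    _ < _ := h3
    _ = _ := by field_simp

/-- Up to factors this compares the mixed second derivatives of the two sides of
`footVector_test_nonneg`. -/
theorem kernel_lt {D : ℕ} (hD : 2 ≤ D) {x y : ℝ} (hy : 0 < y) (hyx : y ≤ x) (hx : D * x ≤ 1) :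
    (1 + D * (x * y)) ^ (D - 1) * (1 + D * (x * y) + D ^ 2 * (x * y)) <
      (1 + y) ^ D * (1 + x) ^ D := by
  have hD0 : (2 : ℝ) ≤ D := by exact_mod_cast hD
  have hx0 : 0 < x := hy.trans_le hyx
  have h1 : (1 + D * (x * y)) ^ (D - 1) ≤ (1 + y) ^ (D - 1) :=
    pow_le_pow_left₀ (by positivity) (by nlinarith) _
  have h2 := one_add_mul_lt_pow_of_two_le hx0 hD
  have e : (1 + y) ^ D = (1 + y) ^ (D - 1) * (1 + y) := by
    rw [← pow_succ]; congr 1; omega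
  rw [e, mul_assoc]
  have h3 : 1 + D * (x * y) + D ^ 2 * (x * y) < (1 + y) * (1 + x) ^ D := by
    have : 1 + D * (x * y) + D ^ 2 * (x * y) ≤ (1 + y) * (1 + D * x) := by
      have : D * x * (D * y) ≤ D * x * 1 :=
        mul_le_mul_of_nonneg_left (by nlinarith) (by positivity)
      nlinarith
    nlinarith
  have h4 : 0 < (1 + y) ^ (D - 1) := by positivity
  calc _ ≤ (1 + y) ^ (D - 1) * (1 + D * (x * y) + D ^ 2 * (x * y)) :=
        mul_le_mul_of_nonneg_right h1 (by positivity)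
    _ < _ := mul_lt_mul_of_pos_left h3 h4

/-- The derivative in `x` of the difference of the two sides of `footVector_test_nonneg`, up to a
positive factor. It vanishes at `y = x` and decreases in `y` by `kernel_lt`. -/
theorem deriv_gap_pos {D : ℕ} (hD : 2 ≤ D) {x y : ℝ} (hy : 0 ≤ y) (hyx : y < x)
    (hx : D * x ≤ 1) :
    0 < ((1 + x) ^ (D + 1) - (1 + y) ^ (D + 1)) * (1 + x) ^ D -
      (D + 1) * (x * (1 + D * (x * x)) ^ D - y * (1 + D * (x * y)) ^ D) := by
  set K : ℝ → ℝ := fun y => ((1 + x) ^ (D + 1) - (1 + y) ^ (D + 1)) * (1 + x) ^ D -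
      (D + 1) * (x * (1 + D * (x * x)) ^ D - y * (1 + D * (x * y)) ^ D) with hK
  have hd : ∀ y, HasDerivAt K (-((D + 1) * ((1 + y) ^ D * (1 + x) ^ D -
      (1 + D * (x * y)) ^ (D - 1) * (1 + D * (x * y) + D ^ 2 * (x * y))))) y := by
    intro y
    have h1 : HasDerivAt (fun y : ℝ => (1 + y) ^ (D + 1)) (((D + 1 : ℕ) : ℝ) * (1 + y) ^ D * 1) y :=
      ((hasDerivAt_id y).const_add 1).pow (D + 1)
    have h2 : HasDerivAt (fun y : ℝ => (1 + D * (x * y)) ^ D)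
        ((D : ℝ) * (1 + D * (x * y)) ^ (D - 1) * (D * (x * 1))) y :=
      ((((hasDerivAt_id y).const_mul x).const_mul (D : ℝ)).const_add 1).pow D
    have h3 := ((h1.const_sub ((1 + x) ^ (D + 1))).mul_const ((1 + x) ^ D)).sub
      (((((hasDerivAt_id y).mul h2).const_sub (x * (1 + D * (x * x)) ^ D))).const_mul ((D : ℝ) + 1))
    refine h3.congr_deriv ?_
    have e : (1 + D * (x * y)) ^ D = (1 + D * (x * y)) ^ (D - 1) * (1 + D * (x * y)) := by
      rw [← pow_succ]; congr 1; omega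
    simp only [id, e]
    push_cast
    ring
  have hanti : StrictAntiOn K (Set.Icc 0 x) := by
    refine strictAntiOn_of_deriv_neg (convex_Icc _ _)
      (fun y _ => (hd y).continuousAt.continuousWithinAt) ?_
    intro y hy
    rw [interior_Icc] at hy
    rw [(hd y).deriv]
    have := kernel_lt hD hy.1 hy.2.le hx
    have hD0 : (0 : ℝ) < D + 1 := by positivity
    nlinarith
  have := hanti (a := y) (b := x) ⟨hy, hyx.le⟩ ⟨hy.trans hyx.le, le_rfl⟩ hyx
  have h0 : K x = 0 := by simp [hK]
  rw [h0] at this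
  exact this

theorem footVector_test_nonneg {D : ℕ} (hD : 2 ≤ D) {x y : ℝ} (hy : 0 ≤ y) (hyx : y < x)
    (hx : D * x ≤ 1) :
    (D + 1) * ((1 + D * (x * x)) ^ (D + 1) - 2 * (1 + D * (x * y)) ^ (D + 1) +
      (1 + D * (y * y)) ^ (D + 1)) < D * ((1 + x) ^ (D + 1) - (1 + y) ^ (D + 1)) ^ 2 := by
  have hD0 : (0 : ℝ) < D := by positivity
  set G : ℝ → ℝ := fun x => D * ((1 + x) ^ (D + 1) - (1 + y) ^ (D + 1)) ^ 2 -
    (D + 1) * ((1 + D * (x * x)) ^ (D + 1) - 2 * (1 + D * (x * y)) ^ (D + 1) +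
      (1 + D * (y * y)) ^ (D + 1)) with hG
  have hd : ∀ x, HasDerivAt G (2 * D * (D + 1) *
      (((1 + x) ^ (D + 1) - (1 + y) ^ (D + 1)) * (1 + x) ^ D -
      (D + 1) * (x * (1 + D * (x * x)) ^ D - y * (1 + D * (x * y)) ^ D))) x := by
    intro x
    have h1 : HasDerivAt (fun x : ℝ => (1 + x) ^ (D + 1)) (((D + 1 : ℕ) : ℝ) * (1 + x) ^ D * 1) x :=
      ((hasDerivAt_id x).const_add 1).pow (D + 1)
    have h2 : HasDerivAt (fun x : ℝ => (1 + D * (x * y)) ^ (D + 1))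
        (((D + 1 : ℕ) : ℝ) * (1 + D * (x * y)) ^ D * (D * (1 * y))) x :=
      ((((hasDerivAt_id x).mul_const y).const_mul (D : ℝ)).const_add 1).pow (D + 1)
    have h3 : HasDerivAt (fun x : ℝ => (1 + D * (x * x)) ^ (D + 1))
        (((D + 1 : ℕ) : ℝ) * (1 + D * (x * x)) ^ D * (D * (1 * x + x * 1))) x :=
      ((((hasDerivAt_id x).mul (hasDerivAt_id x)).const_mul (D : ℝ)).const_add 1).pow (D + 1)
    have h4 := (((h1.sub_const ((1 + y) ^ (D + 1))).pow 2).const_mul (D : ℝ)).sub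
      (((h3.sub (h2.const_mul 2)).add_const ((1 + D * (y * y)) ^ (D + 1))).const_mul ((D : ℝ) + 1))
    refine h4.congr_deriv ?_
    push_cast
    ring
  have hmono : StrictMonoOn G (Set.Icc y x) := by
    refine strictMonoOn_of_deriv_pos (convex_Icc _ _)
      (fun y _ => (hd y).continuousAt.continuousWithinAt) ?_
    intro u hu
    rw [interior_Icc] at hu
    rw [(hd u).deriv]
    have := deriv_gap_pos hD hy hu.1 (le_trans (by gcongr; exact hu.2.le) hx)
    positivity
  have := hmono (a := y) (b := x) ⟨le_rfl, hyx.le⟩ ⟨hyx.le, le_rfl⟩ hyx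
  have h0 : G y = 0 := by simp only [hG]; ring
  rw [h0] at this
  simp only [hG] at this
  linarith

/-- Both sides are compared through `D (x + v) ((1 + x)^d - (1 - v)^d)`: the left one term by term in
the binomial expansion, the right one by the linear lower bound `d (x + v)` of the difference of
powers. -/
theorem footVector_test_neg {D : ℕ} (hD : 2 ≤ D) {x v : ℝ} (hv : 0 < v) (hvx : v ≤ x)
    (hx : D * x ≤ 1) :
    (D + 1) * ((1 + D * (x * x)) ^ (D + 1) - 2 * (1 + D * (x * -v)) ^ (D + 1) +
      (1 + D * (-v * -v)) ^ (D + 1)) < D * ((1 + x) ^ (D + 1) - (1 + -v) ^ (D + 1)) ^ 2 := by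
  have hD0 : (2 : ℝ) ≤ D := by exact_mod_cast hD
  have hx0 : 0 < x := hv.trans_le hvx
  have hS : (D + 1) * (x + v) < (1 + x) ^ (D + 1) - (1 + -v) ^ (D + 1) := by
    have h1 := mul_sub_le_pow_sub_pow (a := 1 + x) (b := 1 + v) (by linarith) (by linarith) (D + 1)
    have h2 := two_mul_lt_pow_sub_pow hv (by nlinarith) hD
    push_cast at h1
    rw [← sub_eq_add_neg]
    linarith
  have key : (1 + D * (x * x)) ^ (D + 1) - 2 * (1 + D * (x * -v)) ^ (D + 1) +
      (1 + D * (-v * -v)) ^ (D + 1) ≤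
      D * (x + v) * ((1 + x) ^ (D + 1) - (1 + -v) ^ (D + 1)) := by
    have e : ∀ a : ℝ, (1 + a) ^ (D + 1) =
        ∑ k ∈ Finset.range (D + 2), a ^ k * ((D + 1).choose k : ℝ) := by
      intro a
      rw [add_comm, add_pow]
      simp
    simp only [e, Finset.mul_sum, ← Finset.sum_sub_distrib, ← Finset.sum_add_distrib]
    refine Finset.sum_le_sum fun k _ => ?_
    have hc : (0 : ℝ) ≤ ((D + 1).choose k : ℝ) := by positivity
    set c := ((D + 1).choose k : ℝ)
    have e2 : (D * (x * x)) ^ k * c - 2 * ((D * (x * -v)) ^ k * c) + (D * (-v * -v)) ^ k * c =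
      D ^ k * (x ^ k - (-v) ^ k) ^ 2 * c := by simp only [mul_pow]; ring
    have e3 : D * (x + v) * (x ^ k * c - (-v) ^ k * c) =
      D * (x + v) * (x ^ k - (-v) ^ k) * c := by ring
    rw [e2, e3]
    refine mul_le_mul_of_nonneg_right ?_ hc
    rcases k with _ | k
    · simp
    have habs : |(-v) ^ (k + 1)| ≤ x ^ k * v := by
      rw [abs_pow, abs_neg, abs_of_pos hv, pow_succ]
      exact mul_le_mul_of_nonneg_right (pow_le_pow_left₀ hv.le hvx _) hv.le
    have hlow := (abs_le.1 habs).1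
    have hup := (abs_le.1 habs).2
    have hxk : x ^ k * v ≤ x ^ (k + 1) := by
      rw [pow_succ]; exact mul_le_mul_of_nonneg_left hvx (by positivity)
    have hT0 : 0 ≤ x ^ (k + 1) - (-v) ^ (k + 1) := by linarith
    have hT : x ^ (k + 1) - (-v) ^ (k + 1) ≤ x ^ k * (x + v) := by
      rw [pow_succ x k]; linarith
    have hDk : (D : ℝ) ^ k * x ^ k ≤ 1 := by
      rw [← mul_pow]; exact pow_le_one₀ (by positivity) hx
    set T := x ^ (k + 1) - (-v) ^ (k + 1)
    calc (D : ℝ) ^ (k + 1) * T ^ 2 = D * (D ^ k * T) * T := by ring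
      _ ≤ D * (x + v) * T := by
        refine mul_le_mul_of_nonneg_right (mul_le_mul_of_nonneg_left ?_ (by positivity)) hT0
        calc (D : ℝ) ^ k * T ≤ D ^ k * (x ^ k * (x + v)) := by gcongr
          _ = (D ^ k * x ^ k) * (x + v) := by ring
          _ ≤ 1 * (x + v) := by gcongr
          _ = x + v := one_mul _
  set S := (1 + x) ^ (D + 1) - (1 + -v) ^ (D + 1)
  have hS0 : 0 < S := lt_trans (by positivity) hS
  calc _ ≤ (D + 1) * (D * (x + v) * S) := by gcongr
    _ = D * (((D + 1) * (x + v)) * S) := by ring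
    _ < D * (S * S) := by gcongr
    _ = _ := by ring

theorem footVector_test_normalized {D : ℕ} (hD : 2 ≤ D) {x y : ℝ} (hy : |y| ≤ x) (hyx : y < x)
    (hx : D * x ≤ 1) :
    (D + 1) * ((1 + D * (x * x)) ^ (D + 1) - 2 * (1 + D * (x * y)) ^ (D + 1) +
      (1 + D * (y * y)) ^ (D + 1)) < D * ((1 + x) ^ (D + 1) - (1 + y) ^ (D + 1)) ^ 2 := by
  rcases le_or_gt 0 y with h | h
  · exact footVector_test_nonneg hD h hyx hx
  · have := footVector_test_neg hD (x := x) (v := -y) (by linarith)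
      (le_trans (neg_le_abs y) hy) hx
    simpa only [neg_neg] using this

/-- The test vector `w = √D e + e'` for `a^d - b^d`, where `a = r e + s e'` and `b = r e + s' e'` with
`e, e'` orthonormal. -/
theorem footVector_test {D : ℕ} (hD : 2 ≤ D) {r s s' : ℝ} (hr : 0 < r) (hs' : |s'| ≤ s)
    (hss : s' < s) (h : D * s ^ 2 ≤ r ^ 2) :
    ((D : ℝ) + 1) ^ (D + 1) * ((r ^ 2 + s * s) ^ (D + 1) - 2 * (r ^ 2 + s * s') ^ (D + 1) +
      (r ^ 2 + s' * s') ^ (D + 1)) <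
      sharpConst D * ((√D * r + s) ^ (D + 1) - (√D * r + s') ^ (D + 1)) ^ 2 := by
  have hD0 : (0 : ℝ) < D := by positivity
  set ρ := √(D : ℝ)
  have hρ0 : 0 < ρ := Real.sqrt_pos.2 hD0
  have hρ2 : ρ ^ 2 = D := Real.sq_sqrt hD0.le
  have hs0 : 0 ≤ s := (abs_nonneg _).trans hs'
  have hpos : 0 < ρ * r := by positivity
  have hx : (D : ℝ) * (s / (ρ * r)) ≤ 1 := by
    rw [← mul_div_assoc, div_le_one hpos, ← hρ2]
    have : ρ * s ≤ r := by
      refine (sq_le_sq₀ (by positivity) hr.le).1 ?_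
      rw [mul_pow, hρ2]; exact h
    nlinarith
  have := footVector_test_normalized hD (x := s / (ρ * r)) (y := s' / (ρ * r))
    (by rw [abs_div, abs_of_pos hpos]; gcongr) (by gcongr) hx
  have e1 : ∀ a b : ℝ, r ^ 2 + a * b = r ^ 2 * (1 + D * (a / (ρ * r) * (b / (ρ * r)))) := by
    intro a b
    rw [← hρ2]; field_simp
  have e2 : ∀ a : ℝ, ρ * r + a = ρ * r * (1 + a / (ρ * r)) := by intro a; field_simp
  rw [e1 s s, e1 s s', e1 s' s', e2 s, e2 s']
  simp only [mul_pow (r ^ 2), mul_pow (ρ * r)]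
  set x := s / (ρ * r)
  set y := s' / (ρ * r)
  have hc : ((D : ℝ) + 1) ^ D * (r ^ 2) ^ (D + 1) > 0 := by positivity
  have h5 := mul_lt_mul_of_pos_left this hc
  have hk := sharpConst_mul hD
  have e3 : ((ρ * r) ^ (D + 1)) ^ 2 = (D : ℝ) ^ (D + 1) * (r ^ 2) ^ (D + 1) := by
    rw [← pow_mul, mul_comm (D + 1) 2, pow_mul, mul_pow ρ r, hρ2, mul_pow]
  calc _ = ((D : ℝ) + 1) ^ D * (r ^ 2) ^ (D + 1) * ((D + 1) *
        ((1 + D * (x * x)) ^ (D + 1) - 2 * (1 + D * (x * y)) ^ (D + 1) +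
      (1 + D * (y * y)) ^ (D + 1))) := by ring
    _ < _ := h5
    _ = (sharpConst D * D ^ D) * (r ^ 2) ^ (D + 1) *
        (D * ((1 + x) ^ (D + 1) - (1 + y) ^ (D + 1)) ^ 2) := by rw [hk]
    _ = sharpConst D * ((D : ℝ) ^ (D + 1) * (r ^ 2) ^ (D + 1)) *
        ((1 + x) ^ (D + 1) - (1 + y) ^ (D + 1)) ^ 2 := by ring
    _ = _ := by rw [← e3]; ring

/-! ### Test vectors for the spectral norm -/

theorem power_smul (c : ℝ) (u : Vec n) : power d (c • u) = c ^ d • power d u := by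
  ext i
  simp [power, outer, Finset.prod_mul_distrib]

/-- Some nonzero `w` shows that `‖A‖_σ` exceeds the bound times `‖A‖_F`, in squared form and without
denominators. -/
def HasStrictWitness (D : ℕ) {n : ℕ} (A : Tensor (D + 1) n) : Prop :=
  ∃ w : Vec n, w ≠ 0 ∧ (‖w‖ ^ 2) ^ (D + 1) * ‖A‖ ^ 2 < sharpConst D * form A w ^ 2

theorem HasStrictWitness.smul {D : ℕ} {A : Tensor (D + 1) n} (h : HasStrictWitness D A) {c : ℝ}
    (hc : c ≠ 0) : HasStrictWitness D (c • A) := by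
  obtain ⟨w, hw, hlt⟩ := h
  refine ⟨w, hw, ?_⟩
  have hc2 : 0 < c ^ 2 := by positivity
  rw [norm_smul, mul_pow, Real.norm_eq_abs, sq_abs, form_smul, mul_pow]
  nlinarith

theorem hasStrictWitness_add {D : ℕ} (hD : 2 ≤ D) {a b : Vec n} (hab : 0 ≤ inner ℝ a b)
    (hne : a ≠ 0 ∨ b ≠ 0) : HasStrictWitness D (power (D + 1) a + power (D + 1) b) := by
  wlog hle : ‖b‖ ≤ ‖a‖ generalizing a b
  · rw [add_comm]
    exact this (by rwa [real_inner_comm]) hne.symm (not_le.1 hle).le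
  have ha : a ≠ 0 := by
    rintro rfl
    rw [norm_zero, norm_le_zero_iff] at hle
    simp [hle] at hne
  have hp : 0 < ‖a‖ ^ 2 := by have := norm_pos_iff.2 ha; positivity
  refine ⟨a, ha, ?_⟩
  have hN := norm_sq_power_add_power (d := D + 1) 1 1 a b
  rw [one_smul, one_smul] at hN
  rw [hN, form_add, form_power, form_power, real_inner_self_eq_norm_sq, real_inner_comm a b]
  have hT : (‖b‖ ^ 2) ^ (D + 1) ≤ (‖a‖ ^ 2) ^ (D + 1) := by gcongr
  have hP : 0 < (‖a‖ ^ 2) ^ (D + 1) := by positivity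
  have hQ : 0 ≤ inner ℝ a b ^ (D + 1) := by positivity
  have hk := two_lt_sharpConst hD
  set P := (‖a‖ ^ 2) ^ (D + 1)
  set Q := inner ℝ a b ^ (D + 1)
  set T := (‖b‖ ^ 2) ^ (D + 1)
  have h1 : 2 * (P + Q) ^ 2 < sharpConst D * (P + Q) ^ 2 := by gcongr
  have h2 : P * T ≤ P * P := by gcongr
  nlinarith

theorem hasStrictWitness_sub {D : ℕ} (hD : 2 ≤ D) {a b : Vec n} (hab : 0 ≤ inner ℝ a b)
    (hne : a ≠ b) : HasStrictWitness D (power (D + 1) a - power (D + 1) b) := by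
  wlog hle : ‖b‖ ≤ ‖a‖ generalizing a b
  · have := (this (by rwa [real_inner_comm]) hne.symm (not_le.1 hle).le).smul
      (c := -1) (by norm_num)
    rwa [neg_one_smul, neg_sub] at this
  have hN := norm_sq_power_add_power (d := D + 1) 1 (-1) a b
  rw [one_smul, neg_one_smul, ← sub_eq_add_neg] at hN
  have hF : ∀ w, form (power (D + 1) a - power (D + 1) b) w =
      inner ℝ a w ^ (D + 1) - inner ℝ b w ^ (D + 1) := by
    intro w
    rw [sub_eq_add_neg, ← neg_one_smul ℝ, form_add, form_smul, form_power, form_power]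
    ring
  have hE : ‖a - b‖ ^ 2 = ‖a‖ ^ 2 - 2 * inner ℝ a b + ‖b‖ ^ 2 := norm_sub_sq_real a b
  have hE0 : 0 < ‖a - b‖ ^ 2 := by have := norm_pos_iff.2 (sub_ne_zero.2 hne); positivity
  have htp : ‖b‖ ^ 2 ≤ ‖a‖ ^ 2 := by gcongr
  have hqp : inner ℝ a b < ‖a‖ ^ 2 := by linarith
  have ha : a ≠ 0 := by
    rintro rfl
    simp at hqp
  have haa := real_inner_self_eq_norm_sq a
  have hbb := real_inner_self_eq_norm_sq b
  have hba : inner ℝ b a = inner ℝ a b := real_inner_comm _ _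
  set p := ‖a‖ ^ 2
  set q := inner ℝ a b
  set t := ‖b‖ ^ 2
  have ht0 : 0 ≤ t := sq_nonneg _
  rcases le_or_gt (p * t - q ^ 2) (D * (p - q) ^ 2) with hcase | hcase
  · refine ⟨a, ha, ?_⟩
    rw [hF, hN, haa, hba]
    have := longVector_test hD hab hqp ht0 htp hcase
    calc _ = p ^ (D + 1) * (p ^ (D + 1) - 2 * q ^ (D + 1) + t ^ (D + 1)) := by ring
      _ < _ := this
  · -- the foot of the perpendicular from the origin to the line through `a` and `b`
    set E := ‖a - b‖
    have hEpos : 0 < E := norm_pos_iff.2 (sub_ne_zero.2 hne)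
    set f : Vec n := a - ((p - q) / E ^ 2) • (a - b) with hf
    have hfe : inner ℝ f (a - b) = (0 : ℝ) := by
      rw [hf, inner_sub_left, inner_smul_left, real_inner_self_eq_norm_sq, inner_sub_right, haa]
      simp only [RCLike.conj_to_real]
      change p - q - (p - q) / E ^ 2 * E ^ 2 = 0
      field_simp
      ring
    have hfb : inner ℝ f b = inner ℝ f a := by
      rw [inner_sub_right] at hfe; linarith
    have hfa : inner ℝ f a = (p * t - q ^ 2) / E ^ 2 := by
      rw [hf, inner_sub_left, inner_smul_left, inner_sub_left, haa, hba]
      simp only [RCLike.conj_to_real]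
      field_simp
      rw [hE]; ring
    have hff : ‖f‖ ^ 2 = (p * t - q ^ 2) / E ^ 2 := by
      rw [← real_inner_self_eq_norm_sq]
      conv_lhs => rw [hf, inner_sub_right, inner_smul_right, ← hf]
      rw [hfe, hfa]; ring
    have hfpos : 0 < ‖f‖ ^ 2 := by
      rw [hff]; refine div_pos (lt_of_le_of_lt ?_ hcase) hE0; positivity
    set r := ‖f‖
    have hr : 0 < r := by
      rcases (norm_nonneg f).eq_or_lt with h | h
      · simp only [r, ← h] at hfpos; norm_num at hfpos
      · exact h
    have hD0 : (0 : ℝ) < D := by positivity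
    set ρ := √(D : ℝ)
    have hρ2 : ρ ^ 2 = D := Real.sq_sqrt hD0.le
    set w : Vec n := (ρ / r) • f + E⁻¹ • (a - b) with hw
    set s := (p - q) / E with hs
    set s' := (q - t) / E with hs'
    have hw2 : ‖w‖ ^ 2 = D + 1 := by
      rw [hw, norm_add_sq_real, norm_smul, norm_smul, inner_smul_left, inner_smul_right, hfe,
        mul_pow, mul_pow, Real.norm_eq_abs, Real.norm_eq_abs, sq_abs, sq_abs]
      change (ρ / r) ^ 2 * r ^ 2 + 2 * _ + E⁻¹ ^ 2 * E ^ 2 = _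
      rw [← hρ2]; field_simp; simp; ring
    have hwa : inner ℝ a w = ρ * r + s := by
      rw [real_inner_comm, hw, inner_add_left, inner_smul_left, inner_smul_left, hfa, ← hff,
        inner_sub_left, haa, hba]
      simp only [RCLike.conj_to_real, hs]
      field_simp
    have hwb : inner ℝ b w = ρ * r + s' := by
      rw [real_inner_comm, hw, inner_add_left, inner_smul_left, inner_smul_left, hfb, hfa, ← hff,
        inner_sub_left, hbb]
      simp only [RCLike.conj_to_real, hs']
      change ρ / r * r ^ 2 + E⁻¹ * (q - t) = _
      field_simp
    have hpE : r ^ 2 + s * s = p := by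
      rw [hff, hs]; field_simp; rw [hE]; ring
    have hqE : r ^ 2 + s * s' = q := by
      rw [hff, hs, hs']; field_simp; rw [hE]; ring
    have htE : r ^ 2 + s' * s' = t := by
      rw [hff, hs']; field_simp; rw [hE]; ring
    have := footVector_test (D := D) hD hr (s := s) (s' := s')
      (by
        rw [hs', hs, abs_div, abs_of_pos hEpos]
        refine div_le_div_of_nonneg_right ?_ hEpos.le
        rw [abs_le]; constructor <;> linarith)
      (by rw [hs', hs]; exact div_lt_div_of_pos_right (by linarith) hEpos)
      (by
        rw [hff, hs, div_pow, ← mul_div_assoc]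
        exact div_le_div_of_nonneg_right hcase.le hE0.le)
    rw [hpE, hqE, htE] at this
    refine ⟨w, ?_, ?_⟩
    · intro h0
      rw [h0] at hw2
      simp at hw2
      linarith
    · rw [hF, hN, hwa, hwb, hw2]
      calc _ = ((D : ℝ) + 1) ^ (D + 1) * (p ^ (D + 1) - 2 * q ^ (D + 1) + t ^ (D + 1)) := by ring
        _ < _ := this

/-- Since real `d`-th roots of `|α|` exist, coefficients of powers can be taken to be `± 1`. -/
theorem exists_smul_power_eq (hd : d ≠ 0) (α : ℝ) (u : Vec n) :
    ∃ (ε : ℝ) (a : Vec n), (ε = 1 ∨ ε = -1) ∧ α • power d u = ε • power d a := by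
  have hroot : (|α| ^ ((d : ℝ)⁻¹)) ^ d = |α| := Real.rpow_inv_natCast_pow (abs_nonneg α) hd
  rcases le_or_gt 0 α with h | h
  · refine ⟨1, (|α| ^ ((d : ℝ)⁻¹)) • u, Or.inl rfl, ?_⟩
    rw [power_smul, hroot, abs_of_nonneg h, one_smul]
  · refine ⟨-1, (|α| ^ ((d : ℝ)⁻¹)) • u, Or.inr rfl, ?_⟩
    rw [power_smul, hroot, abs_of_neg h, smul_smul]
    congr 1; ring

theorem hasStrictWitness_of_sum_powers {D : ℕ} (hD : 2 ≤ D) {α β : ℝ} {u v : Vec n}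
    (hA : α • power (D + 1) u + β • power (D + 1) v ≠ 0) :
    HasStrictWitness D (α • power (D + 1) u + β • power (D + 1) v) := by
  obtain ⟨ε, a, hε, ha⟩ := exists_smul_power_eq (d := D + 1) (by omega) α u
  obtain ⟨δ, b, hδ, hb⟩ := exists_smul_power_eq (d := D + 1) (by omega) β v
  rw [ha, hb] at hA ⊢
  obtain ⟨δ', b', hδ', hb', hin⟩ : ∃ (δ' : ℝ) (b' : Vec n), (δ' = 1 ∨ δ' = -1) ∧
      δ • power (D + 1) b = δ' • power (D + 1) b' ∧ 0 ≤ inner ℝ a b' := by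
    rcases le_or_gt 0 (inner ℝ a b) with h | h
    · exact ⟨δ, b, hδ, rfl, h⟩
    · refine ⟨δ * (-1) ^ (D + 1), -b, ?_, ?_, by rw [inner_neg_right]; linarith⟩
      · rcases neg_one_pow_eq_or ℝ (D + 1) with h1 | h1 <;> rcases hδ with h2 | h2 <;>
          simp [h1, h2]
      · rw [← neg_one_smul ℝ b, power_smul, smul_smul, mul_assoc, ← mul_pow]
        simp
  rw [hb'] at hA ⊢
  have hε0 : ε ≠ 0 := by rcases hε with h | h <;> simp [h]
  have hcase : δ' = ε ∨ δ' = -ε := by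
    rcases hε with h1 | h1 <;> rcases hδ' with h2 | h2 <;> simp [h1, h2]
  rcases hcase with h | h
  · rw [h, ← smul_add] at hA ⊢
    refine (hasStrictWitness_add hD hin ?_).smul hε0
    by_contra! h0
    apply hA
    rw [h0.1, h0.2, ← zero_smul ℝ (0 : Vec n), power_smul]
    simp
  · rw [h, neg_smul, ← sub_eq_add_neg, ← smul_sub] at hA ⊢
    refine (hasStrictWitness_sub hD hin ?_).smul hε0
    rintro rfl
    simp at hA

/-- If `c` is large compared with `s`, the witness is `θ`; otherwise it is `√D θ ± η`, which is optimal
for `c = 0`. -/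
theorem hasStrictWitness_power_add_tangent {D : ℕ} (hD : 2 ≤ D) {θ η : Vec n} (hθ : ‖θ‖ = 1)
    (hη : ‖η‖ = 1) (h : inner ℝ θ η = 0) {c s : ℝ} (hc : c ≠ 0) :
    HasStrictWitness D (c • power (D + 1) θ + s • tangent (D + 1) θ η) := by
  have hN := norm_sq_power_add_tangent (d := D + 1) hθ hη h c s
  have hθ' : inner ℝ θ θ = (1 : ℝ) := by rw [real_inner_self_eq_norm_sq, hθ]; norm_num
  have hη' : inner ℝ η η = (1 : ℝ) := by rw [real_inner_self_eq_norm_sq, hη]; norm_num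
  have h' : inner ℝ η θ = (0 : ℝ) := by rw [real_inner_comm, h]
  have hD0 : (2 : ℝ) ≤ D := by exact_mod_cast hD
  have hk := two_lt_sharpConst hD
  have hc2 : 0 < c ^ 2 := by positivity
  push_cast at hN
  rcases le_or_gt (4 * D * (D + 1) ^ 2 * s ^ 2) (c ^ 2) with hcase | hcase
  · refine ⟨θ, by rintro rfl; simp at hθ, ?_⟩
    rw [hN, hθ, form_add, form_smul, form_smul, form_power, form_tangent, hθ', h']
    simp only [one_pow, mul_one, mul_zero, add_zero, one_mul]
    have : (D + 1) * s ^ 2 ≤ c ^ 2 := by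
      refine le_trans ?_ hcase
      refine mul_le_mul_of_nonneg_right ?_ (sq_nonneg s)
      nlinarith
    nlinarith
  · have hDp : (0 : ℝ) < D := by linarith
    set ρ := √(D : ℝ)
    have hρ0 : 0 < ρ := Real.sqrt_pos.2 hDp
    have hρ2 : ρ ^ 2 = D := Real.sq_sqrt hDp.le
    -- choose the sign of the second coordinate so that both terms reinforce each other
    obtain ⟨σ, hσ2, hσ⟩ : ∃ σ : ℝ, σ ^ 2 = 1 ∧ 0 ≤ c * (σ * s) := by
      rcases le_or_gt 0 (c * s) with h0 | h0
      · exact ⟨1, by norm_num, by simpa using h0⟩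
      · exact ⟨-1, by norm_num, by linarith⟩
    have hw2 : ‖ρ • θ + σ • η‖ ^ 2 = D + 1 := by
      rw [norm_add_sq_real, norm_smul, norm_smul, inner_smul_left, inner_smul_right, h, hθ, hη,
        mul_one, mul_one, Real.norm_eq_abs, Real.norm_eq_abs, sq_abs, sq_abs, hρ2, hσ2]
      simp
    refine ⟨ρ • θ + σ • η, ?_, ?_⟩
    · intro h0
      rw [h0] at hw2
      simp at hw2
      linarith
    · rw [hw2, hN, form_add, form_smul, form_smul, form_power, form_tangent, inner_add_right,
        inner_add_right, inner_smul_right, inner_smul_right, inner_smul_right, inner_smul_right,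
        hθ', hη', h, h']
      simp only [mul_one, mul_zero, add_zero, zero_add, Nat.add_sub_cancel]
      push_cast
      have e : c * ρ ^ (D + 1) + s * ((D + 1) * (ρ ^ D * σ)) =
          ρ ^ D * (c * ρ + (D + 1) * (σ * s)) := by ring
      rw [e, mul_pow, ← pow_mul, mul_comm D 2, pow_mul, hρ2, ← mul_assoc, sharpConst_mul hD,
        pow_succ, mul_assoc]
      refine mul_lt_mul_of_pos_left ?_ (by positivity)
      have hss : (σ * s) ^ 2 = s ^ 2 := by rw [mul_pow, hσ2, one_mul]
      rw [← hss] at hcase ⊢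
      set m := σ * s
      have h3 : |c| < 2 * ρ * (D + 1) * |m| := by
        refine lt_of_pow_lt_pow_left₀ 2 (by positivity) ?_
        rw [sq_abs]
        calc c ^ 2 < _ := hcase
          _ = 4 * ρ ^ 2 * (D + 1) ^ 2 * |m| ^ 2 := by rw [sq_abs, hρ2]
          _ = _ := by ring
      have h4 : c ^ 2 < 2 * ρ * (D + 1) * (c * m) := by
        rw [← abs_of_nonneg hσ, abs_mul, ← sq_abs c]
        have : 0 < |c| := abs_pos.2 hc
        nlinarith
      have e5 : (c * ρ + (D + 1) * m) ^ 2 = D * c ^ 2 + 2 * ρ * (D + 1) * (c * m) +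
          (D + 1) ^ 2 * m ^ 2 := by rw [← hρ2]; ring
      rw [e5]
      nlinarith

/-! ### The spectral norm of a tangent tensor -/

/-- The weighted inequality of the arithmetic and geometric means for `X^D Y`. -/
theorem sharpConst_mul_pow_mul_le {D : ℕ} (hD : 1 ≤ D) {X Y : ℝ} (hX : 0 ≤ X) (hY : 0 ≤ Y) :
    sharpConst D * (D + 1) * (X ^ D * Y) ≤ (X + Y) ^ (D + 1) := by
  have hD0 : (0 : ℝ) < D := by positivity
  rcases hX.eq_or_lt with rfl | hX
  · rw [zero_pow (by omega)]; simp; positivity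
  set z := X / D with hz
  have hz0 : 0 < z := by positivity
  have hXz : X = D * z := by rw [hz]; field_simp
  have hb : 1 + ((D + 1 : ℕ) : ℝ) * ((Y - z) / ((D + 1) * z)) ≤
      (1 + (Y - z) / ((D + 1) * z)) ^ (D + 1) := by
    refine one_add_mul_le_pow ?_ _
    rw [le_div_iff₀ (by positivity)]
    nlinarith
  push_cast at hb
  have e1 : 1 + ((D : ℝ) + 1) * ((Y - z) / ((D + 1) * z)) = Y / z := by field_simp; ring
  have e2 : 1 + (Y - z) / (((D : ℝ) + 1) * z) = (X + Y) / ((D + 1) * z) := by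
    rw [hXz]; field_simp; ring
  rw [e1, e2, div_pow, le_div_iff₀ (by positivity)] at hb
  refine le_trans (le_of_eq ?_) hb
  have : sharpConst D * X ^ D = (D + 1) ^ D * z ^ D := by
    unfold sharpConst
    rw [hXz, ← mul_pow, ← mul_pow]
    congr 1
    field_simp
  calc _ = sharpConst D * X ^ D * ((D + 1) * Y) := by ring
    _ = _ := by rw [this, mul_pow, pow_succ, pow_succ]; field_simp

/-- The bound `(1 - 1/d)^{(d-1)/2}` for `d = D + 1`; see `rpow_eq_bound`. -/
noncomputable def bound (D : ℕ) : ℝ := (√(sharpConst D))⁻¹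

theorem sharpConst_pos {D : ℕ} (hD : 2 ≤ D) : 0 < sharpConst D :=
  lt_trans two_pos (two_lt_sharpConst hD)

theorem rpow_eq_bound {D : ℕ} (hD : 2 ≤ D) :
    (1 - 1 / ((D + 1 : ℕ) : ℝ)) ^ ((((D + 1 : ℕ) : ℝ) - 1) / 2) = bound D := by
  have hD0 : (0 : ℝ) < D := by positivity
  have h0 : (0 : ℝ) < D / (D + 1) := by positivity
  have h1 : 1 - 1 / ((D + 1 : ℕ) : ℝ) = D / (D + 1) := by push_cast; field_simp; ring
  have h2 : (((D + 1 : ℕ) : ℝ) - 1) / 2 = D * (1 / 2) := by push_cast; ring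
  rw [h1, h2, Real.rpow_mul h0.le, Real.rpow_natCast, ← Real.sqrt_eq_rpow, bound, sharpConst,
    ← Real.sqrt_inv, ← inv_pow, inv_div]

theorem bound_pos {D : ℕ} (hD : 2 ≤ D) : 0 < bound D :=
  inv_pos.2 (Real.sqrt_pos.2 (sharpConst_pos hD))

theorem sharpConst_mul_bound_sq {D : ℕ} (hD : 2 ≤ D) : sharpConst D * bound D ^ 2 = 1 := by
  rw [bound, inv_pow, Real.sq_sqrt (sharpConst_pos hD).le, mul_inv_cancel₀ (sharpConst_pos hD).ne']

theorem bound_mul_norm_le_iff {D : ℕ} (hD : 2 ≤ D) (A : Tensor (D + 1) n) {w : Vec n}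
    (hw : w ≠ 0) : bound D * ‖A‖ ≤ |form A w| / ‖w‖ ^ (D + 1) ↔
      (‖w‖ ^ 2) ^ (D + 1) * ‖A‖ ^ 2 ≤ sharpConst D * form A w ^ 2 := by
  have hw0 : 0 < ‖w‖ ^ (D + 1) := pow_pos (norm_pos_iff.2 hw) _
  have hb := bound_pos hD
  rw [le_div_iff₀ hw0, ← sq_le_sq₀ (by positivity) (abs_nonneg _), sq_abs,
    ← mul_le_mul_iff_right₀ (sharpConst_pos hD)]
  have : sharpConst D * (bound D * ‖A‖ * ‖w‖ ^ (D + 1)) ^ 2 =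
      (sharpConst D * bound D ^ 2) * ((‖w‖ ^ 2) ^ (D + 1) * ‖A‖ ^ 2) := by ring
  rw [this, sharpConst_mul_bound_sq hD, one_mul]

theorem le_bound_mul_norm_iff {D : ℕ} (hD : 2 ≤ D) (A : Tensor (D + 1) n) {w : Vec n}
    (hw : w ≠ 0) : |form A w| / ‖w‖ ^ (D + 1) ≤ bound D * ‖A‖ ↔
      sharpConst D * form A w ^ 2 ≤ (‖w‖ ^ 2) ^ (D + 1) * ‖A‖ ^ 2 := by
  have hw0 : 0 < ‖w‖ ^ (D + 1) := pow_pos (norm_pos_iff.2 hw) _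
  have hb := bound_pos hD
  rw [div_le_iff₀ hw0, ← sq_le_sq₀ (abs_nonneg _) (by positivity), sq_abs,
    ← mul_le_mul_iff_right₀ (sharpConst_pos hD)]
  have : sharpConst D * (bound D * ‖A‖ * ‖w‖ ^ (D + 1)) ^ 2 =
      (sharpConst D * bound D ^ 2) * ((‖w‖ ^ 2) ^ (D + 1) * ‖A‖ ^ 2) := by ring
  rw [this, sharpConst_mul_bound_sq hD, one_mul]

theorem pos_of_vec_ne_zero {w : Vec n} (hw : w ≠ 0) : 1 ≤ n := by
  rcases Nat.eq_zero_or_pos n with rfl | h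
  · exact absurd (Subsingleton.elim w 0) hw
  · exact h

theorem HasStrictWitness.bound_mul_norm_lt {D : ℕ} (hD : 2 ≤ D) {A : Tensor (D + 1) n}
    (h : HasStrictWitness D A) : bound D * ‖A‖ < specNorm A := by
  obtain ⟨w, hw, hlt⟩ := h
  refine lt_of_lt_of_le ?_ (le_specNorm (pos_of_vec_ne_zero hw) A hw)
  rw [← not_le, le_bound_mul_norm_iff hD A hw, not_le]
  exact hlt

theorem specNorm_smul_tangent {D : ℕ} (hD : 2 ≤ D) {θ η : Vec n} (hθ : ‖θ‖ = 1)
    (hη : ‖η‖ = 1) (h : inner ℝ θ η = 0) (s : ℝ) :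
    specNorm (s • tangent (D + 1) θ η) = bound D * ‖s • tangent (D + 1) θ η‖ := by
  have hN := norm_sq_power_add_tangent (d := D + 1) hθ hη h 0 s
  rw [zero_smul, zero_add] at hN
  have hθ' : inner ℝ θ θ = (1 : ℝ) := by rw [real_inner_self_eq_norm_sq, hθ]; norm_num
  have hη' : inner ℝ η η = (1 : ℝ) := by rw [real_inner_self_eq_norm_sq, hη]; norm_num
  have h' : inner ℝ η θ = (0 : ℝ) := by rw [real_inner_comm, h]
  have hθ0 : θ ≠ 0 := by rintro rfl; simp at hθ
  have hn := pos_of_vec_ne_zero hθ0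
  have hDp : (0 : ℝ) < D := by positivity
  have hF : ∀ u, form (s • tangent (D + 1) θ η) u ^ 2 =
      s ^ 2 * (D + 1) ^ 2 * ((inner ℝ θ u ^ 2) ^ D * inner ℝ η u ^ 2) := by
    intro u
    rw [form_smul, form_tangent, Nat.add_sub_cancel]
    push_cast
    ring
  refine le_antisymm (specNorm_le hn _ fun u hu => ?_) ?_
  · rw [le_bound_mul_norm_iff hD _ hu, hF, hN]
    have hbessel : inner ℝ θ u ^ 2 + inner ℝ η u ^ 2 ≤ ‖u‖ ^ 2 := by
      have h0 := sq_nonneg ‖u - (inner ℝ θ u • θ + inner ℝ η u • η)‖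
      rw [norm_sub_sq_real, norm_add_sq_real, norm_smul, norm_smul, inner_add_right,
        inner_smul_right, inner_smul_right, inner_smul_right, inner_smul_left, h, hθ, hη,
        real_inner_comm θ u, real_inner_comm η u, mul_one, mul_one, Real.norm_eq_abs,
        Real.norm_eq_abs, sq_abs, sq_abs] at h0
      simp only [mul_zero] at h0
      linarith
    have h1 := sharpConst_mul_pow_mul_le (D := D) (by omega) (sq_nonneg (inner ℝ θ u))
      (sq_nonneg (inner ℝ η u))
    have h2 : (inner ℝ θ u ^ 2 + inner ℝ η u ^ 2) ^ (D + 1) ≤ (‖u‖ ^ 2) ^ (D + 1) := by gcongr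
    push_cast
    calc _ = (s ^ 2 * (D + 1)) *
          (sharpConst D * (D + 1) * ((inner ℝ θ u ^ 2) ^ D * inner ℝ η u ^ 2)) := by ring
      _ ≤ (s ^ 2 * (D + 1)) * (‖u‖ ^ 2) ^ (D + 1) := by gcongr; exact h1.trans h2
      _ = _ := by ring
  -- the maximum is attained at `√D θ + η`
  · set ρ := √(D : ℝ)
    have hρ2 : ρ ^ 2 = D := Real.sq_sqrt hDp.le
    have hw2 : ‖ρ • θ + η‖ ^ 2 = D + 1 := by
      rw [norm_add_sq_real, norm_smul, inner_smul_left, h, hθ, hη,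
        mul_one, Real.norm_eq_abs, sq_abs, hρ2]
      simp
    have hw : ρ • θ + η ≠ 0 := by
      intro h0
      rw [h0] at hw2
      simp at hw2
      linarith
    refine le_trans ?_ (le_specNorm hn _ hw)
    rw [bound_mul_norm_le_iff hD _ hw, hF, hN, hw2, inner_add_right, inner_add_right,
      inner_smul_right, inner_smul_right, hθ', hη', h, h']
    simp only [mul_one, mul_zero, add_zero, zero_add, one_pow]
    rw [hρ2]
    push_cast
    refine le_of_eq ?_
    calc _ = s ^ 2 * (D + 1) ^ 2 * ((D : ℝ) + 1) ^ D := by ring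
      _ = _ := by rw [← sharpConst_mul hD]; ring

/-! ### Symmetric tensors of border rank at most two -/

theorem multi_update_outer (x w : Fin d → Vec n) (i : Fin d) (ξ : Vec n) :
    multi (outer x) (Function.update w i ξ) =
      inner ℝ (x i) ξ * ∏ k ∈ Finset.univ.erase i, inner ℝ (x k) (w k) := by
  rw [multi_outer, ← Finset.mul_prod_erase _ _ (Finset.mem_univ i), Function.update_self]
  congr 1
  refine Finset.prod_congr rfl fun k hk => ?_
  rw [Function.update_of_ne (Finset.ne_of_mem_erase hk)]

/-- The vector obtained by contracting `A` with `w` in all places but `i`. -/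
noncomputable def fiber (i : Fin d) (w : Fin d → Vec n) (A : Tensor d n) : Vec n :=
  WithLp.toLp 2 fun l => multi A (Function.update w i (EuclideanSpace.single l 1))

theorem inner_fiber (i : Fin d) (w : Fin d → Vec n) (A : Tensor d n) (ξ : Vec n) :
    inner ℝ (fiber i w A) ξ = multi A (Function.update w i ξ) := by
  have h : ξ = ∑ l, ξ l • EuclideanSpace.single l (1 : ℝ) := by
    ext m
    simp [Finset.sum_apply, Pi.single_apply]
  conv_rhs => rw [h, MultilinearMap.map_update_sum]
  simp only [MultilinearMap.map_update_smul, PiLp.inner_apply, fiber]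
  rfl

theorem continuous_fiber (i : Fin d) (w : Fin d → Vec n) :
    Continuous (fiber i w : Tensor d n → Vec n) := by
  refine (PiLp.continuous_toLp 2 _).comp (continuous_pi fun l => ?_)
  exact continuous_multi.comp (continuous_id.prodMk continuous_const)

/-- The fibres of a sum of two elementary tensors lie in the span of the two factors in place `i`. -/
theorem fiber_mem_of_rank {B : Tensor d n} {c : Fin 2 → ℝ} {x : Fin 2 → Fin d → Vec n}
    (hB : B = ∑ j, c j • outer (x j)) (i : Fin d) (w : Fin d → Vec n) :
    fiber i w B ∈ Submodule.span ℝ (Set.range fun j => x j i) := by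
  have : fiber i w B =
      ∑ j, (c j * ∏ k ∈ Finset.univ.erase i, inner ℝ (x j k) (w k)) • x j i := by
    refine ext_inner_right ℝ fun ξ => ?_
    rw [inner_fiber, hB, multi_sum, sum_inner]
    refine Finset.sum_congr rfl fun j _ => ?_
    rw [multi_smul, multi_update_outer, inner_smul_left]
    simp only [RCLike.conj_to_real]
    ring
  rw [this]
  exact Submodule.sum_mem _ fun j _ =>
    Submodule.smul_mem _ _ (Submodule.subset_span ⟨j, rfl⟩)

/-- The span of all fibres of `A` in place `i`. -/
noncomputable def fiberSpan (i : Fin d) (A : Tensor d n) : Submodule ℝ (Vec n) :=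
  Submodule.span ℝ (Set.range fun w => fiber i w A)

theorem BorderRankLE.finrank_fiberSpan_le {A : Tensor d n} (hA : BorderRankLE 2 A) (i : Fin d) :
    Module.finrank ℝ (fiberSpan i A) ≤ 2 := by
  by_contra! hlt
  obtain ⟨f, hf, -, hind⟩ :=
    Submodule.exists_fun_fin_finrank_span_eq ℝ (Set.range fun w => fiber i w A)
  choose w hw using hf
  have h3 : LinearIndependent ℝ fun j : Fin 3 => fiber i (w (Fin.castLE hlt j)) A := by
    have := hind.comp (Fin.castLE hlt) (Fin.castLE_injective hlt)
    rwa [show f ∘ Fin.castLE hlt = fun j => fiber i (w (Fin.castLE hlt j)) A from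
      funext fun j => (hw _).symm] at this
  have hopen : IsOpen {B : Tensor d n |
      LinearIndependent ℝ fun j : Fin 3 => fiber i (w (Fin.castLE hlt j)) B} :=
    isOpen_setOfPred_linearIndependent.preimage
      (f := fun B : Tensor d n => fun j : Fin 3 => fiber i (w (Fin.castLE hlt j)) B)
      (continuous_pi fun j => continuous_fiber i _)
  obtain ⟨B, hB, c, x, hx⟩ := mem_closure_iff.1 hA _ hopen h3
  have hspan : Submodule.span ℝ (Set.range fun j : Fin 3 => fiber i (w (Fin.castLE hlt j)) B) ≤
      Submodule.span ℝ (Set.range fun j => x j i) := by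
    rw [Submodule.span_le]
    rintro _ ⟨j, rfl⟩
    exact fiber_mem_of_rank hx i _
  have h1 := Submodule.finrank_mono hspan
  have h2 : Module.finrank ℝ (Submodule.span ℝ (Set.range fun j => x j i)) ≤ 2 :=
    (finrank_range_le_card (R := ℝ) fun j => x j i).trans_eq (by simp)
  have h4 := finrank_span_eq_card hB
  simp at h4
  omega

theorem IsSymm.multi_eq_zero_of_mem_orthogonal {A : Tensor d n} (hA : IsSymm A) (i : Fin d)
    {v : Fin d → Vec n} {j : Fin d} (hv : v j ∈ (fiberSpan i A)ᗮ) : multi A v = 0 := by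
  rw [← hA.multi_comp (Equiv.swap i j)]
  have : v ∘ Equiv.swap i j = Function.update (v ∘ Equiv.swap i j) i (v j) := by
    rw [eq_comm, Function.update_eq_self_iff]
    simp
  rw [this, ← inner_fiber]
  exact hv _ (Submodule.subset_span ⟨_, rfl⟩)

theorem multi_add_of_vanish {A : Tensor d n} {S : Submodule ℝ (Vec n)}
    (hS : ∀ (v : Fin d → Vec n) j, v j ∈ S → multi A v = 0) (p y : Fin d → Vec n)
    (hy : ∀ k, y k ∈ S) : multi A (p + y) = multi A p := by
  rw [MultilinearMap.map_add_univ, Finset.sum_eq_single Finset.univ]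
  · rw [Finset.piecewise_univ]
  · intro s _ hs
    obtain ⟨k, hk⟩ : ∃ k, k ∉ s := by
      by_contra! h
      exact hs (Finset.eq_univ_iff_forall.2 h)
    refine hS _ k ?_
    rw [Finset.piecewise_eq_of_notMem _ _ _ hk]
    exact hy k
  · simp

theorem multi_piecewise_smul (A : Tensor d n) (a b : Fin d → ℝ) (η ζ : Vec n)
    (s : Finset (Fin d)) :
    multi A (s.piecewise (fun k => a k • η) fun k => b k • ζ) =
      (∏ k, s.piecewise a b k) * multi A (s.piecewise (fun _ => η) fun _ => ζ) := by
  rw [← smul_eq_mul, ← MultilinearMap.map_smul_univ]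
  congr 1
  funext k
  by_cases h : k ∈ s <;> simp [h]

/-- If the form vanishes on arguments containing both `η` and `ζ`, only the two pure terms of its
expansion remain. -/
theorem multi_of_mixed_vanish (hd : 1 ≤ d) {A : Tensor d n} {η ζ : Vec n}
    (h : ∀ (v : Fin d → Vec n) i j, i ≠ j → v i = η → v j = ζ → multi A v = 0)
    (a b : Fin d → ℝ) :
    multi A ((fun k => a k • η) + fun k => b k • ζ) =
      (∏ k, a k) * multi A (fun _ => η) + (∏ k, b k) * multi A (fun _ => ζ) := by
  have hne : (Finset.univ : Finset (Fin d)) ≠ ∅ :=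
    Finset.nonempty_iff_ne_empty.1 ⟨⟨0, hd⟩, Finset.mem_univ _⟩
  rw [MultilinearMap.map_add_univ, Finset.sum_eq_add Finset.univ ∅ hne]
  · simp only [multi_piecewise_smul]
    simp only [Finset.piecewise_univ, Finset.piecewise_empty]
  · rintro s - ⟨hs, hs'⟩
    obtain ⟨i, hi⟩ := Finset.nonempty_iff_ne_empty.2 hs'
    obtain ⟨j, hj⟩ : ∃ k, k ∉ s := by
      by_contra! h
      exact hs (Finset.eq_univ_iff_forall.2 h)
    rw [multi_piecewise_smul, h _ i j (by rintro rfl; exact hj hi) (by simp [hi]) (by simp [hj]),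
      mul_zero]
  · simp
  · simp

/-- If the form vanishes on arguments containing `η` twice, only the terms of degree at most one in `η`
remain in its expansion. -/
theorem multi_of_double_vanish {A : Tensor d n} (hA : IsSymm A) (i₀ : Fin d) {η θ : Vec n}
    (h : ∀ (v : Fin d → Vec n) i j, i ≠ j → v i = η → v j = η → multi A v = 0)
    (a b : Fin d → ℝ) :
    multi A ((fun k => a k • η) + fun k => b k • θ) =
      multi A (fun _ => θ) * ∏ k, b k + multi A (Function.update (fun _ => θ) i₀ η) *
        ∑ j, a j * ∏ k ∈ Finset.univ.erase j, b k := by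
  classical
  have hinj : Function.Injective (singleton : Fin d → Finset (Fin d)) := Finset.singleton_injective
  have hnot : (∅ : Finset (Fin d)) ∉ Finset.univ.map ⟨singleton, hinj⟩ := by simp
  rw [MultilinearMap.map_add_univ,
    ← Finset.sum_subset (Finset.subset_univ (insert ∅ (Finset.univ.map ⟨singleton, hinj⟩))),
    Finset.sum_insert hnot, Finset.sum_map]
  · simp only [multi_piecewise_smul, Finset.piecewise_empty, Function.Embedding.coeFn_mk]
    rw [mul_comm (multi A fun _ => θ), Finset.mul_sum]
    refine congrArg₂ (· + ·) (by rw [MultilinearMap.map_smul_univ, smul_eq_mul])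
      (Finset.sum_congr rfl fun j _ => ?_)
    have e1 : ∏ k, ({j} : Finset (Fin d)).piecewise a b k =
        a j * ∏ k ∈ Finset.univ.erase j, b k := by
      rw [← Finset.mul_prod_erase _ _ (Finset.mem_univ j)]
      congr 1
      · simp
      · refine Finset.prod_congr rfl fun k hk => ?_
        simp [Finset.ne_of_mem_erase hk]
    have e2 : multi A (({j} : Finset (Fin d)).piecewise (fun _ => η) fun _ => θ) =
        multi A (Function.update (fun _ => θ) i₀ η) := by
      rw [Finset.piecewise_singleton, ← hA.multi_comp (Equiv.swap i₀ j)]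
      congr 1
      funext k
      simp only [Function.comp_apply, Function.update_apply, Equiv.swap_apply_eq_iff,
        Equiv.swap_apply_right]
    rw [e1, e2, mul_comm]
  · intro s _ hs
    simp only [Finset.mem_insert, Finset.mem_map, Finset.mem_univ, true_and,
      Function.Embedding.coeFn_mk, not_or, not_exists] at hs
    obtain ⟨i, hi⟩ := Finset.nonempty_iff_ne_empty.2 hs.1
    obtain ⟨j, hj, hji⟩ : ∃ j ∈ s, j ≠ i := by
      by_contra! hc
      exact hs.2 i (Finset.ext fun k => ⟨fun hk => by
        rw [Finset.mem_singleton.1 hk]; exact hi, fun hk => Finset.mem_singleton.2 (hc k hk)⟩)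
    rw [multi_piecewise_smul, h _ j i hji (by simp [hj]) (by simp [hi]), mul_zero]

theorem exists_unit_mem_inner_eq_zero {V : Submodule ℝ (Vec n)} (hV : Module.finrank ℝ V = 2)
    (x : Vec n) : ∃ η ∈ V, ‖η‖ = 1 ∧ inner ℝ x η = 0 := by
  let f : V →ₗ[ℝ] ℝ := (innerSL ℝ x).toLinearMap.comp V.subtype
  have hk : LinearMap.ker f ≠ ⊥ := LinearMap.ker_ne_bot_of_finrank_lt (by simp [hV])
  obtain ⟨ξ, hξ, hξ0⟩ := Submodule.exists_mem_ne_zero_of_ne_bot hk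
  have h0 : ‖(ξ : Vec n)‖ ≠ 0 := by simpa using hξ0
  have h1 : inner ℝ x (ξ : Vec n) = 0 := by simpa [f] using hξ
  refine ⟨‖(ξ : Vec n)‖⁻¹ • (ξ : Vec n), V.smul_mem _ ξ.2, ?_, ?_⟩
  · rw [norm_smul, norm_inv, norm_norm, inv_mul_cancel₀ h0]
  · rw [inner_smul_right, h1, mul_zero]

/-- The pairs of unit vectors of `V` form a compact set, so the tensors for which the conclusion holds
form a closed set. It contains the tensors `x₁ ⊗ ⋯ ⊗ x_d + y₁ ⊗ ⋯ ⊗ y_d`, with `η ⊥ x_i` and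
`ζ ⊥ y_j`. -/
theorem BorderRankLE.exists_annihilating_pair {A : Tensor d n} (hA : BorderRankLE 2 A)
    {V : Submodule ℝ (Vec n)} (hV : Module.finrank ℝ V = 2) {i j : Fin d} (hij : i ≠ j) :
    ∃ η ∈ V, ∃ ζ ∈ V, ‖η‖ = 1 ∧ ‖ζ‖ = 1 ∧
      ∀ v : Fin d → Vec n, v i = η → v j = ζ → multi A v = 0 := by
  set K : Set (Vec n) := (V : Set (Vec n)) ∩ Metric.sphere 0 1
  have hK : IsCompact K :=
    (isCompact_sphere (0 : Vec n) 1).inter_left V.closed_of_finiteDimensional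
  have hKc : CompactSpace (K ×ˢ K : Set (Vec n × Vec n)) :=
    isCompact_iff_compactSpace.1 (hK.prod hK)
  set Z : Set (Tensor d n × (K ×ˢ K : Set (Vec n × Vec n))) :=
    {p | ∀ w : Fin d → Vec n,
      multi p.1 (Function.update (Function.update w i (p.2 : Vec n × Vec n).1) j
        (p.2 : Vec n × Vec n).2) = 0} with hZ
  have hZc : IsClosed Z := by
    rw [hZ]
    simp only [Set.ofPred_forall]
    refine isClosed_iInter fun w => isClosed_eq ?_ continuous_const
    refine continuous_multi.comp (continuous_fst.prodMk ?_)
    exact (continuous_const.update i (by fun_prop)).update j (by fun_prop)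
  have hSc : IsClosed (Prod.fst '' Z) := isClosedMap_fst_of_compactSpace Z hZc
  have hsub : {B : Tensor d n | RankLE 2 B} ⊆ Prod.fst '' Z := by
    rintro B ⟨c, x, hx⟩
    obtain ⟨η, hηV, hη, hη0⟩ := exists_unit_mem_inner_eq_zero hV (x 0 i)
    obtain ⟨ζ, hζV, hζ, hζ0⟩ := exists_unit_mem_inner_eq_zero hV (x 1 j)
    refine ⟨(B, ⟨(η, ζ), ⟨hηV, by simpa using hη⟩, ⟨hζV, by simpa using hζ⟩⟩), ?_, rfl⟩
    intro w
    rw [hx, multi_sum, Fin.sum_univ_two, multi_smul, multi_smul, multi_update_outer (x 1), hζ0]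
    rw [zero_mul, mul_zero, add_zero, multi_outer, Finset.prod_eq_zero (Finset.mem_univ i),
      mul_zero]
    rw [Function.update_of_ne hij, Function.update_self, hη0]
  obtain ⟨⟨B, p⟩, hp, rfl⟩ := closure_minimal hsub hSc hA
  obtain ⟨⟨η, ζ⟩, ⟨hη, hη1⟩, ⟨hζ, hζ1⟩⟩ := p
  refine ⟨η, hη, ζ, hζ, by simpa using hη1, by simpa using hζ1, fun v hv hv' => ?_⟩
  have := hp v
  simpa [← hv, ← hv'] using this

theorem exists_perm_apply_eq {i₀ j₀ i j : Fin d} (h₀ : i₀ ≠ j₀) (h : i ≠ j) :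
    ∃ σ : Equiv.Perm (Fin d), σ i₀ = i ∧ σ j₀ = j := by
  refine ⟨Equiv.swap (Equiv.swap i₀ i j₀) j * Equiv.swap i₀ i, ?_, ?_⟩
  · rw [Equiv.Perm.mul_apply, Equiv.swap_apply_left, Equiv.swap_apply_of_ne_of_ne _ h]
    intro he
    rw [eq_comm, Equiv.swap_apply_eq_iff, Equiv.swap_apply_right] at he
    exact h₀ he.symm
  · rw [Equiv.Perm.mul_apply, Equiv.swap_apply_left]

/-- For symmetric `A` the vanishing in two fixed places carries over to any two places. -/
theorem IsSymm.multi_eq_zero_of_pair {A : Tensor d n} (hA : IsSymm A) {i₀ j₀ : Fin d}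
    (h₀ : i₀ ≠ j₀) {η ζ : Vec n}
    (h : ∀ v : Fin d → Vec n, v i₀ = η → v j₀ = ζ → multi A v = 0)
    (v : Fin d → Vec n) (i j : Fin d) (hij : i ≠ j) (hi : v i = η) (hj : v j = ζ) :
    multi A v = 0 := by
  obtain ⟨σ, h1, h2⟩ := exists_perm_apply_eq h₀ hij
  rw [← hA.multi_comp σ]
  exact h _ (by simp [h1, hi]) (by simp [h2, hj])

theorem sub_mem_orthogonal {V : Submodule ℝ (Vec n)} (hV : Module.finrank ℝ V = 2)
    {η θ : Vec n} (hη : η ∈ V) (hθ : θ ∈ V) (hη1 : ‖η‖ = 1) (hθ1 : ‖θ‖ = 1)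
    (h : inner ℝ η θ = 0) (v : Vec n) : v - (inner ℝ η v • η + inner ℝ θ v • θ) ∈ Vᗮ := by
  have hon : Orthonormal ℝ ![η, θ] := by
    constructor
    · intro i; fin_cases i <;> simp [hη1, hθ1]
    · intro i j hij
      fin_cases i <;> fin_cases j <;> simp_all [real_inner_comm]
  have hspan : Submodule.span ℝ (Set.range ![η, θ]) = V := by
    refine Submodule.eq_of_le_of_finrank_eq ?_ ?_
    · rw [Submodule.span_le]
      rintro _ ⟨i, rfl⟩
      fin_cases i <;> simp [hη, hθ]
    · rw [finrank_span_eq_card hon.linearIndependent, hV]; simp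
  have h' : inner ℝ θ η = (0 : ℝ) := by rw [real_inner_comm, h]
  rw [Submodule.mem_orthogonal, ← hspan]
  intro u hu
  induction hu using Submodule.span_induction with
  | mem u hu =>
    obtain ⟨i, rfl⟩ := hu
    fin_cases i <;>
      simp [inner_sub_right, inner_add_right, inner_smul_right, hη1, hθ1, h, h']
  | zero => simp
  | add x y _ _ hx hy => rw [inner_add_left, hx, hy, add_zero]
  | smul a x _ hx => rw [inner_smul_left, hx, mul_zero]

/-- Normal forms of symmetric tensors of border rank at most two. -/
theorem IsSymm.classify {A : Tensor d n} (hd : 3 ≤ d) (hA : IsSymm A) (hb : BorderRankLE 2 A) :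
    (∃ (α β : ℝ) (u v : Vec n), A = α • power d u + β • power d v) ∨
    ∃ (c s : ℝ) (θ η : Vec n), ‖θ‖ = 1 ∧ ‖η‖ = 1 ∧ inner ℝ θ η = 0 ∧
      A = c • power d θ + s • tangent d θ η := by
  set i₀ : Fin d := ⟨0, by omega⟩
  set j₀ : Fin d := ⟨1, by omega⟩
  have hij : i₀ ≠ j₀ := by simp [i₀, j₀]
  set V := fiberSpan i₀ A with hVdef
  have hle : Module.finrank ℝ V ≤ 2 := hb.finrank_fiberSpan_le i₀
  have hperp : ∀ (v : Fin d → Vec n) j, v j ∈ Vᗮ → multi A v = 0 :=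
    fun v j hv => hA.multi_eq_zero_of_mem_orthogonal i₀ hv
  rcases hle.lt_or_eq with hlt | hV
  · left
    obtain ⟨⟨u, huV⟩, hu⟩ := finrank_le_one_iff.1 (Nat.lt_succ_iff.1 hlt)
    have hVu : V = Submodule.span ℝ {u} := by
      refine le_antisymm (fun x hx => ?_) ?_
      · obtain ⟨c, hc⟩ := hu ⟨x, hx⟩
        exact Submodule.mem_span_singleton.2 ⟨c, congrArg Subtype.val hc⟩
      · rw [Submodule.span_singleton_le_iff_mem]; exact huV
    -- for `u = 0` the factor `(‖u‖ ^ 2)⁻¹` is `0`, and the decomposition below remains valid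
    refine ⟨(‖u‖ ^ 2)⁻¹ ^ d * multi A (fun _ => u), 0, u, u, ?_⟩
    rw [zero_smul, add_zero]
    refine ext_multi fun v => ?_
    have hdec : v = (fun k => ((‖u‖ ^ 2)⁻¹ * inner ℝ u (v k)) • u) +
        fun k => v k - ((‖u‖ ^ 2)⁻¹ * inner ℝ u (v k)) • u := by
      funext k; simp
    conv_lhs => rw [hdec]
    rw [multi_add_of_vanish hperp, MultilinearMap.map_smul_univ, multi_smul, multi_power,
      Finset.prod_mul_distrib, smul_eq_mul]
    · simp; ring
    · intro k
      rw [hVu, Submodule.mem_orthogonal_singleton_iff_inner_right, inner_sub_right,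
        inner_smul_right, real_inner_self_eq_norm_sq]
      rcases eq_or_ne u 0 with rfl | h0
      · simp
      · have : ‖u‖ ≠ 0 := norm_ne_zero_iff.2 h0
        field_simp; ring
  · obtain ⟨η, hηV, ζ, hζV, hη1, hζ1, hpair⟩ :=
      hb.exists_annihilating_pair hV hij
    obtain ⟨θ, hθV, hθ1, hηθ⟩ := exists_unit_mem_inner_eq_zero hV η
    have hmix := hA.multi_eq_zero_of_pair hij hpair
    have hθη : inner ℝ θ η = (0 : ℝ) := by rw [real_inner_comm, hηθ]
    have hres := sub_mem_orthogonal hV hηV hθV hη1 hθ1 hηθ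
    have hζ : ζ = inner ℝ η ζ • η + inner ℝ θ ζ • θ := by
      have h1 := hres ζ
      have h2 : ζ - (inner ℝ η ζ • η + inner ℝ θ ζ • θ) ∈ V :=
        V.sub_mem hζV (V.add_mem (V.smul_mem _ hηV) (V.smul_mem _ hθV))
      have := Submodule.inner_right_of_mem_orthogonal h2 h1
      exact sub_eq_zero.1 (inner_self_eq_zero.1 this)
    set x := inner ℝ η ζ
    set y := inner ℝ θ ζ
    rcases eq_or_ne y 0 with hy | hy
    · right
      rw [hy, zero_smul, add_zero] at hζ
      have hx : x ≠ 0 := by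
        rintro hx
        rw [hζ, hx] at hζ1; simp at hζ1
      have hdbl : ∀ (v : Fin d → Vec n) i j, i ≠ j → v i = η → v j = η → multi A v = 0 := by
        intro v i j hij hi hj
        have h1 := hmix (Function.update v j (x • v j)) i j hij
          (by rw [Function.update_of_ne hij, hi]) (by simp [hj, hζ])
        rw [MultilinearMap.map_update_smul, Function.update_eq_self, smul_eq_mul] at h1
        exact (mul_eq_zero.1 h1).resolve_left hx
      refine ⟨multi A fun _ => θ, multi A (Function.update (fun _ => θ) i₀ η), θ, η, hθ1, hη1, hθη,
        ext_multi fun v => ?_⟩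
      have hdec : v = ((fun k => inner ℝ η (v k) • η) + fun k => inner ℝ θ (v k) • θ) +
          fun k => v k - (inner ℝ η (v k) • η + inner ℝ θ (v k) • θ) := by
        funext k; simp
      conv_lhs => rw [hdec]
      rw [multi_add_of_vanish hperp _ _ fun k => hres _, multi_of_double_vanish hA i₀ hdbl,
        multi_add, multi_smul, multi_smul, multi_power, multi_tangent]
    · left
      have hθeq : θ = y⁻¹ • ζ - (y⁻¹ * x) • η := by
        rw [hζ, smul_add, smul_smul, smul_smul, inv_mul_cancel₀ hy, one_smul]
        abel
      -- the coordinates with respect to `η, ζ` are the inner products with the dual basis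
      refine ⟨multi A fun _ => η, multi A fun _ => ζ, η - (y⁻¹ * x) • θ, y⁻¹ • θ,
        ext_multi fun v => ?_⟩
      have hdec : v = ((fun k => inner ℝ (η - (y⁻¹ * x) • θ) (v k) • η) +
          fun k => inner ℝ (y⁻¹ • θ) (v k) • ζ) +
          fun k => v k - (inner ℝ η (v k) • η + inner ℝ θ (v k) • θ) := by
        funext k
        simp only [Pi.add_apply, inner_sub_left, inner_smul_left, RCLike.conj_to_real]
        conv_lhs => rw [← add_sub_cancel (inner ℝ η (v k) • η + inner ℝ θ (v k) • θ) (v k)]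
        congr 1
        generalize inner ℝ η (v k) = p
        generalize inner ℝ θ (v k) = q
        conv_lhs => rw [hθeq]
        module
      conv_lhs => rw [hdec]
      rw [multi_add_of_vanish hperp _ _ fun k => hres _, multi_of_mixed_vanish (by omega) hmix,
        multi_add, multi_smul, multi_smul, multi_power, multi_power]
      ring

/-! ### Tangent tensors have rank above two -/

theorem multi_two_eq_zero {θ η : Vec n} (h : inner ℝ θ η = 0) (c s : ℝ) {v : Fin d → Vec n}
    {i j : Fin d} (hij : i ≠ j) (hi : v i = η) (hj : v j = η) :
    multi (c • power d θ + s • tangent d θ η) v = 0 := by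
  rw [multi_add, multi_smul, multi_smul, multi_power, multi_tangent,
    Finset.prod_eq_zero (Finset.mem_univ i) (by rw [hi, h]), Finset.sum_eq_zero]
  · simp
  · intro k _
    rcases eq_or_ne i k with rfl | hik
    · rw [Finset.prod_eq_zero (Finset.mem_erase.2 ⟨hij.symm, Finset.mem_univ j⟩) (by rw [hj, h]),
        mul_zero]
    · rw [Finset.prod_eq_zero (Finset.mem_erase.2 ⟨hik, Finset.mem_univ i⟩) (by rw [hi, h]),
        mul_zero]

theorem multi_update_eq {θ η : Vec n} (hθ : ‖θ‖ = 1) (hη : ‖η‖ = 1) (h : inner ℝ θ η = 0)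
    (c s : ℝ) (j : Fin d) :
    multi (c • power d θ + s • tangent d θ η) (Function.update (fun _ => θ) j η) = s := by
  have hηη : inner ℝ η η = (1 : ℝ) := by rw [real_inner_self_eq_norm_sq, hη]; norm_num
  have hθθ : inner ℝ θ θ = (1 : ℝ) := by rw [real_inner_self_eq_norm_sq, hθ]; norm_num
  have h' : inner ℝ η θ = (0 : ℝ) := by rw [real_inner_comm, h]
  rw [multi_add, multi_smul, multi_smul, multi_power, multi_tangent,
    Finset.prod_eq_zero (Finset.mem_univ j) (by simp [h]), Finset.sum_eq_single j]
  · rw [Function.update_self, hηη, Finset.prod_eq_one]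
    · ring
    · intro k hk
      rw [Function.update_of_ne (Finset.ne_of_mem_erase hk), hθθ]
  · intro k _ hk
    rw [Function.update_of_ne hk, h', zero_mul]
  · simp

/-- If a tangent tensor were a sum of two elementary tensors, the second one would vanish on `η` in the
first place. Applied to both terms this is absurd, because the tangent tensor does not vanish on
`η ⊗ θ ⊗ ⋯ ⊗ θ`. -/
theorem inner_eq_zero_of_two_terms (hd : 3 ≤ d) {θ η : Vec n} (hθ : ‖θ‖ = 1) (hη : ‖η‖ = 1)
    (h : inner ℝ θ η = 0) {c s a b : ℝ} (hs : s ≠ 0) {x y : Fin d → Vec n}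
    (he : c • power d θ + s • tangent d θ η = a • outer x + b • outer y)
    (i : Fin d) (hi : i = ⟨0, by omega⟩) :
    inner ℝ (y i) η = 0 := by
  set j : Fin d := ⟨1, by omega⟩ with hj
  set k : Fin d := ⟨2, by omega⟩ with hk
  have hij : i ≠ j := by simp [hi, hj]
  have hik : i ≠ k := by simp [hi, hk]
  have hjk : j ≠ k := by simp [hj, hk]
  set A := c • power d θ + s • tangent d θ η with hA
  -- a combination of `θ` and `η` that is orthogonal to `y i`, possibly zero
  set ξ : Vec n := inner ℝ (y i) θ • η + (-inner ℝ (y i) η) • θ with hξ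
  have hξ0 : inner ℝ (y i) ξ = 0 := by
    rw [hξ, inner_add_right, inner_smul_right, inner_smul_right]; ring
  -- contracting with `ξ` leaves a rank-one bilinear form in the places `j` and `k`
  have hprod : ∀ p q : Vec n,
      multi A (Function.update (Function.update (Function.update (fun _ => θ) i ξ) j p) k q) =
      inner ℝ (x j) p * inner ℝ (x k) q * (a * inner ℝ (x i) ξ *
        ∏ l ∈ ((Finset.univ.erase k).erase j).erase i, inner ℝ (x l) θ) := by
    intro p q
    have hy : multi (outer y) (Function.update (Function.update
        (Function.update (fun _ => θ) i ξ) j p) k q) = 0 := by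
      rw [multi_outer, Finset.prod_eq_zero (Finset.mem_univ i)]
      rw [Function.update_of_ne hik, Function.update_of_ne hij, Function.update_self, hξ0]
    rw [he, multi_add, multi_smul, multi_smul, hy, mul_zero, add_zero, multi_update_outer,
      ← Finset.mul_prod_erase _ _ (Finset.mem_erase.2 ⟨hjk, Finset.mem_univ j⟩),
      ← Finset.mul_prod_erase _ _ (Finset.mem_erase.2 ⟨hij, Finset.mem_erase.2
        ⟨hik, Finset.mem_univ i⟩⟩), Function.update_self, Function.update_of_ne hij,
      Function.update_self]
    have : ∏ l ∈ ((Finset.univ.erase k).erase j).erase i,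
        inner ℝ (x l) (Function.update (Function.update (fun _ => θ) i ξ) j p l) =
        ∏ l ∈ ((Finset.univ.erase k).erase j).erase i, inner ℝ (x l) θ := by
      refine Finset.prod_congr rfl fun l hl => ?_
      simp only [Finset.mem_erase] at hl
      rw [Function.update_of_ne hl.2.1, Function.update_of_ne hl.1]
    rw [this]
    ring
  have hηη : multi A (Function.update (Function.update (Function.update (fun _ => θ) i ξ) j η)
      k η) = 0 :=
    multi_two_eq_zero h c s hjk (by rw [Function.update_of_ne hjk, Function.update_self])
      (by rw [Function.update_self])
  have hθη : ∀ l : Fin d, i ≠ l →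
      multi A (Function.update (Function.update (fun _ => θ) i ξ) l η) =
        -inner ℝ (y i) η * s := by
    intro l hl
    rw [Function.update_comm hl, hξ, MultilinearMap.map_update_add, MultilinearMap.map_update_smul,
      MultilinearMap.map_update_smul, smul_eq_mul, smul_eq_mul]
    have h1 : multi A (Function.update (Function.update (fun _ => θ) l η) i η) = 0 :=
      multi_two_eq_zero h c s hl (by rw [Function.update_self])
        (by rw [Function.update_of_ne hl.symm, Function.update_self])
    have h2 : multi A (Function.update (Function.update (fun _ => θ) l η) i θ) = s := by
      rw [Function.update_comm hl.symm, Function.update_eq_self]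
      exact multi_update_eq hθ hη h c s l
    rw [h1, h2]; ring
  -- a rank-one form that vanishes at `(η, η)` vanishes at `(η, θ)` or at `(θ, η)`
  have e1 := hθη j hij
  have e2 := hθη k hik
  have e3 : Function.update (Function.update (fun _ => θ) i ξ) j η =
      Function.update (Function.update (Function.update (fun _ => θ) i ξ) j η) k θ := by
    rw [eq_comm, Function.update_eq_self_iff, Function.update_of_ne hjk.symm,
      Function.update_of_ne hik.symm]
  have e4 : Function.update (fun _ => θ) i ξ =
      Function.update (Function.update (fun _ => θ) i ξ) j θ := by
    rw [eq_comm, Function.update_eq_self_iff, Function.update_of_ne hij.symm]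
  rw [e3, hprod] at e1
  rw [e4, hprod] at e2
  rw [hprod] at hηη
  have : (-inner ℝ (y i) η * s) * (-inner ℝ (y i) η * s) = 0 := by
    linear_combination (inner ℝ (y i) η * s) * e1 - (inner ℝ (x j) η * inner ℝ (x k) θ *
      (a * inner ℝ (x i) ξ * ∏ l ∈ ((Finset.univ.erase k).erase j).erase i, inner ℝ (x l) θ)) * e2 +
      (inner ℝ (x j) θ * inner ℝ (x k) θ * (a * inner ℝ (x i) ξ *
        ∏ l ∈ ((Finset.univ.erase k).erase j).erase i, inner ℝ (x l) θ)) * hηη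
  have := mul_self_eq_zero.1 this
  simpa [hs] using this

theorem not_rankLE_two (hd : 3 ≤ d) {θ η : Vec n} (hθ : ‖θ‖ = 1) (hη : ‖η‖ = 1)
    (h : inner ℝ θ η = 0) {c s : ℝ} (hs : s ≠ 0) :
    ¬ RankLE 2 (c • power d θ + s • tangent d θ η) := by
  rintro ⟨a, x, he⟩
  rw [Fin.sum_univ_two] at he
  have h1 := inner_eq_zero_of_two_terms hd hθ hη h hs he _ rfl
  have h0 := inner_eq_zero_of_two_terms hd hθ hη h hs (he.trans (add_comm _ _)) _ rfl
  have := multi_update_eq hθ hη h c s (⟨0, by omega⟩ : Fin d)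
  rw [he, multi_add, multi_smul, multi_smul, multi_update_outer, multi_update_outer, h0, h1] at this
  simp at this
  exact hs this.symm

/-- For symmetric tensors, rank at most two over `ℝ` implies symmetric rank at most two. -/
theorem IsSymm.exists_eq_power_add_power {A : Tensor d n} (hd : 3 ≤ d) (hA : IsSymm A)
    (hr : RankLE 2 A) : ∃ (α β : ℝ) (u v : Vec n), A = α • power d u + β • power d v := by
  rcases hA.classify hd (subset_closure hr) with h | ⟨c, s, θ, η, hθ, hη, h, rfl⟩
  · exact h
  · have hs : s = 0 := by
      by_contra hs
      exact not_rankLE_two hd hθ hη h hs hr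
    exact ⟨c, 0, θ, θ, by simp [hs]⟩

/-! ### The minimizers -/

/-- `Q` maps `d e₁^{d-1} e₂` to `d q₁^{d-1} q₂`, where `q₁, q₂` are the first two columns of `Q`. -/
theorem act_W (hd : 1 ≤ d) (hn : 2 ≤ n) (Q : Matrix (Fin n) (Fin n) ℝ) :
    act Q (W d n hn) = tangent d (WithLp.toLp 2 fun i => Q i ⟨0, by omega⟩)
      (WithLp.toLp 2 fun i => Q i ⟨1, by omega⟩) := by
  rw [W_eq_tangent hd, act_tangent]
  congr 1 <;>
  · ext i
    simp [e₁, e₂, Matrix.toLpLin_apply]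

theorem inner_columns (Q : Matrix (Fin n) (Fin n) ℝ) (j k : Fin n) :
    inner ℝ (WithLp.toLp 2 fun i => Q i j : Vec n) (WithLp.toLp 2 fun i => Q i k) =
      (Q.transpose * Q) j k := by
  rw [PiLp.inner_apply, Matrix.mul_apply]
  refine Finset.sum_congr rfl fun i _ => ?_
  simp [Matrix.transpose_apply, mul_comm]

theorem exists_orthogonal_columns {θ η : Vec n} (hθ : ‖θ‖ = 1) (hη : ‖η‖ = 1)
    (h : inner ℝ θ η = 0) (hn : 2 ≤ n) :
    ∃ Q ∈ Matrix.orthogonalGroup (Fin n) ℝ,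
      (WithLp.toLp 2 fun i => Q i ⟨0, by omega⟩ : Vec n) = θ ∧
      (WithLp.toLp 2 fun i => Q i ⟨1, by omega⟩ : Vec n) = η := by
  set a : Fin n := ⟨0, by omega⟩
  set b : Fin n := ⟨1, by omega⟩
  have hba : b ≠ a := by simp [a, b]
  set v : Fin n → Vec n := Function.update (fun _ => η) a θ
  have hva : v a = θ := Function.update_self ..
  have hvb : v b = η := Function.update_of_ne hba ..
  have hon : Orthonormal ℝ (({a, b} : Set (Fin n)).domRestrict v) := by
    constructor
    · rintro ⟨i, rfl | rfl⟩
      · simpa [hva] using hθ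
      · simpa [hvb] using hη
    · rintro ⟨i, rfl | rfl⟩ ⟨j, rfl | rfl⟩ hij
      · exact absurd rfl hij
      · simpa [hva, hvb] using h
      · rw [real_inner_comm] at h
        simpa [hva, hvb] using h
      · exact absurd rfl hij
  obtain ⟨B, hB⟩ := hon.exists_orthonormalBasis_extension_of_card_eq (by simp)
  refine ⟨Matrix.of fun i j => B j i, ?_, ?_, ?_⟩
  · rw [Matrix.mem_orthogonalGroup_iff']
    ext j k
    rw [← inner_columns]
    have := orthonormal_iff_ite.1 B.orthonormal j k
    rw [Matrix.one_apply, ← this]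
    rfl
  · rw [← hva, ← hB a (by simp)]; rfl
  · rw [← hvb, ← hB b (by simp)]; rfl

theorem norm_e₁ (hn : 2 ≤ n) : ‖e₁ n hn‖ = 1 := by simp [e₁]

theorem norm_e₂ (hn : 2 ≤ n) : ‖e₂ n hn‖ = 1 := by simp [e₂]

theorem inner_e₁_e₂ (hn : 2 ≤ n) : inner ℝ (e₁ n hn) (e₂ n hn) = 0 := by
  simp [e₁, e₂, EuclideanSpace.inner_single_left]

theorem smul_tangent_ne_zero {θ η : Vec n} (hθ : ‖θ‖ = 1) (hη : ‖η‖ = 1) (h : inner ℝ θ η = 0)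
    (hd : 1 ≤ d) {s : ℝ} (hs : s ≠ 0) : s • tangent d θ η ≠ 0 := by
  have hN := norm_sq_power_add_tangent (d := d) hθ hη h 0 s
  rw [zero_smul, zero_add] at hN
  intro h0
  rw [h0, norm_zero] at hN
  have : 0 < (d : ℝ) * s ^ 2 := by positivity
  simp at hN
  rcases hN with h1 | h1
  · omega
  · exact hs h1

theorem bound_mul_norm_lt_specNorm {D : ℕ} (hD : 2 ≤ D) {A : Tensor (D + 1) n} (hA : IsSymm A)
    (hr : RankLE 2 A) (h0 : A ≠ 0) : bound D * ‖A‖ < specNorm A := by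
  obtain ⟨α, β, u, v, rfl⟩ := hA.exists_eq_power_add_power (by omega) hr
  exact (hasStrictWitness_of_sum_powers hD h0).bound_mul_norm_lt hD

theorem bound_mul_norm_lt_or_eq_tangent {D : ℕ} (hD : 2 ≤ D) {A : Tensor (D + 1) n}
    (hA : IsSymm A) (hb : BorderRankLE 2 A) (h0 : A ≠ 0) :
    bound D * ‖A‖ < specNorm A ∨ ∃ (s : ℝ) (θ η : Vec n), s ≠ 0 ∧ ‖θ‖ = 1 ∧ ‖η‖ = 1 ∧
      inner ℝ θ η = 0 ∧ A = s • tangent (D + 1) θ η := by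
  rcases hA.classify (by omega) hb with ⟨α, β, u, v, rfl⟩ | ⟨c, s, θ, η, hθ, hη, h, rfl⟩
  · exact Or.inl ((hasStrictWitness_of_sum_powers hD h0).bound_mul_norm_lt hD)
  · rcases eq_or_ne c 0 with rfl | hc
    · rw [zero_smul, zero_add] at h0 ⊢
      exact Or.inr ⟨s, θ, η, by rintro rfl; simp at h0, hθ, hη, h, rfl⟩
    · exact Or.inl ((hasStrictWitness_power_add_tangent hD hθ hη h hc).bound_mul_norm_lt hD)

theorem specNorm_div_norm_tangent {D : ℕ} (hD : 2 ≤ D) {θ η : Vec n} (hθ : ‖θ‖ = 1)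
    (hη : ‖η‖ = 1) (h : inner ℝ θ η = 0) {s : ℝ} (hs : s ≠ 0) :
    specNorm (s • tangent (D + 1) θ η) / ‖s • tangent (D + 1) θ η‖ = bound D := by
  rw [specNorm_smul_tangent hD hθ hη h, mul_div_assoc, div_self, mul_one]
  exact norm_ne_zero_iff.2 (smul_tangent_ne_zero hθ hη h (by omega) hs)

theorem bound_le_ratio {D : ℕ} (hD : 2 ≤ D) {A : Tensor (D + 1) n}
    (hA : IsSymm A) (hb : BorderRankLE 2 A) (h0 : A ≠ 0) : bound D ≤ specNorm A / ‖A‖ := by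
  rcases bound_mul_norm_lt_or_eq_tangent hD hA hb h0 with h | ⟨s, θ, η, hs, hθ, hη, h, rfl⟩
  · rw [le_div_iff₀ (norm_pos_iff.2 h0)]; exact h.le
  · exact (specNorm_div_norm_tangent hD hθ hη h hs).ge

theorem isGLB_ratio {D : ℕ} (hD : 2 ≤ D) (hn : 2 ≤ n) :
    IsGLB {ρ : ℝ | ∃ A : Tensor (D + 1) n, IsSymm A ∧ A ≠ 0 ∧ RankLE 2 A ∧
      ρ = specNorm A / ‖A‖} (bound D) := by
  constructor
  · rintro _ ⟨A, hA, h0, hr, rfl⟩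
    exact bound_le_ratio hD hA (subset_closure hr) h0
  · intro c hc
    have hT := tendsto_tangent (d := D + 1) (e₁ n hn) (e₂ n hn)
    have h0 := smul_tangent_ne_zero (d := D + 1) (norm_e₁ hn) (norm_e₂ hn) (inner_e₁_e₂ hn)
      (by omega) one_ne_zero
    have hval := specNorm_div_norm_tangent hD (norm_e₁ hn) (norm_e₂ hn) (inner_e₁_e₂ hn)
      one_ne_zero
    rw [one_smul] at h0 hval
    have hlim := (((continuous_specNorm (by omega)).tendsto _).comp hT).div hT.norm
      (norm_ne_zero_iff.2 h0)
    rw [hval] at hlim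
    refine ge_of_tendsto hlim ?_
    filter_upwards [hT.eventually_ne h0] with t ht
    refine hc ⟨_, ?_, ht, ?_, rfl⟩
    · rw [sub_eq_add_neg, ← neg_one_smul ℝ (power _ _)]
      exact ((isSymm_power _).add ((isSymm_power _).smul _)).smul _
    · rw [smul_sub, sub_eq_add_neg, ← neg_smul]
      exact rankLE_smul_power_add _ _ _ _

end RealTensor

theorem theorem1 (d n : ℕ) (hd : 3 ≤ d) :
    -- the strict inequality for symmetric tensors of rank at most two
    (∀ A : RealTensor.Tensor d n, RealTensor.IsSymm A → RealTensor.RankLE 2 A → A ≠ 0 →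
      RealTensor.specNorm A > (1 - 1 / (d : ℝ)) ^ (((d : ℝ) - 1) / 2) * ‖A‖) ∧
    ∀ hn : 2 ≤ n,
      -- the bound is sharp
      IsGLB {ρ : ℝ | ∃ A : RealTensor.Tensor d n, RealTensor.IsSymm A ∧ A ≠ 0 ∧
          RealTensor.RankLE 2 A ∧ ρ = RealTensor.specNorm A / ‖A‖}
        ((1 - 1 / (d : ℝ)) ^ (((d : ℝ) - 1) / 2)) ∧
      -- the minimum over symmetric tensors of border rank at most two
      IsLeast {ρ : ℝ | ∃ A : RealTensor.Tensor d n, RealTensor.IsSymm A ∧ A ≠ 0 ∧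
          RealTensor.BorderRankLE 2 A ∧ ρ = RealTensor.specNorm A / ‖A‖}
        ((1 - 1 / (d : ℝ)) ^ (((d : ℝ) - 1) / 2)) ∧
      -- the tensor `W_d` is a limit of symmetric tensors of rank at most two
      Tendsto (fun t : ℝ => t⁻¹ •
          (RealTensor.power d (RealTensor.e₁ n hn + t • RealTensor.e₂ n hn) -
            RealTensor.power d (RealTensor.e₁ n hn)))
        (𝓝[≠] 0) (𝓝 (RealTensor.W d n hn)) ∧
      -- the minimizers are exactly the images of `W_d` under scaling and orthogonal maps
      ∀ A : RealTensor.Tensor d n,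
        (RealTensor.IsSymm A ∧ A ≠ 0 ∧ RealTensor.BorderRankLE 2 A ∧
          RealTensor.specNorm A / ‖A‖ = (1 - 1 / (d : ℝ)) ^ (((d : ℝ) - 1) / 2)) ↔
        ∃ (s : ℝ) (Q : Matrix (Fin n) (Fin n) ℝ), s ≠ 0 ∧
          Q ∈ Matrix.orthogonalGroup (Fin n) ℝ ∧
          A = s • RealTensor.act Q (RealTensor.W d n hn) := by

  obtain ⟨D, rfl⟩ : ∃ D, d = D + 1 := ⟨d - 1, by omega⟩
  have hD : 2 ≤ D := by omega
  rw [RealTensor.rpow_eq_bound hD]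
  refine ⟨fun A hA hr h0 => RealTensor.bound_mul_norm_lt_specNorm hD hA hr h0, fun hn =>
    ⟨RealTensor.isGLB_ratio hD hn, ⟨?_, ?_⟩, ?_, fun A => ⟨?_, ?_⟩⟩⟩
  · have h := RealTensor.specNorm_div_norm_tangent hD (RealTensor.norm_e₁ hn)
      (RealTensor.norm_e₂ hn) (RealTensor.inner_e₁_e₂ hn) one_ne_zero
    exact ⟨_, (RealTensor.isSymm_tangent _ _).smul _, RealTensor.smul_tangent_ne_zero
      (RealTensor.norm_e₁ hn) (RealTensor.norm_e₂ hn) (RealTensor.inner_e₁_e₂ hn) (by omega)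
      one_ne_zero, RealTensor.borderRankLE_smul_tangent _ _ _, h.symm⟩
  · rintro _ ⟨A, hA, h0, hb, rfl⟩
    exact RealTensor.bound_le_ratio hD hA hb h0
  · rw [RealTensor.W_eq_tangent (by omega)]
    exact RealTensor.tendsto_tangent _ _
  · rintro ⟨hA, h0, hb, he⟩
    rcases RealTensor.bound_mul_norm_lt_or_eq_tangent hD hA hb h0 with
      h | ⟨s, θ, η, hs, hθ, hη, h, rfl⟩
    · rw [← he, div_mul_cancel₀ _ (norm_ne_zero_iff.2 h0)] at h
      exact absurd h (lt_irrefl _)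
    · obtain ⟨Q, hQ, h1, h2⟩ := RealTensor.exists_orthogonal_columns hθ hη h hn
      exact ⟨s, Q, hs, hQ, by rw [RealTensor.act_W (by omega), h1, h2]⟩
  · rintro ⟨s, Q, hs, hQ, rfl⟩
    rw [Matrix.mem_orthogonalGroup_iff'] at hQ
    have hunit : ∀ j, ‖(WithLp.toLp 2 fun i => Q i j : RealTensor.Vec n)‖ = 1 := by
      intro j
      rw [← sq_eq_sq₀ (norm_nonneg _) zero_le_one, ← real_inner_self_eq_norm_sq,
        RealTensor.inner_columns, hQ]
      simp
    have horth := RealTensor.inner_columns Q ⟨0, by omega⟩ ⟨1, by omega⟩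
    rw [hQ, Matrix.one_apply_ne (by simp)] at horth
    rw [RealTensor.act_W (by omega)]
    exact ⟨(RealTensor.isSymm_tangent _ _).smul _, RealTensor.smul_tangent_ne_zero
      (hunit _) (hunit _) horth (by omega) hs, RealTensor.borderRankLE_smul_tangent _ _ _,
      RealTensor.specNorm_div_norm_tangent hD (hunit _) (hunit _) horth hs⟩
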